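/- Let $1<a\le b<a^2$ and $\delta\ge 0$, and set $\tau:=\log_a b$. Let $(X,d)$ be a connected, noncompact, complete metric space such that - $d$ is strictly intrinsic ($X$ is a length space): any two points $x,y\in X$ are joined by a continuous path of length $d(x,y)$; - $X$ is $\delta$-hyperbolic: with $(y,z)_x:=\tfrac12\big(d(x,y)+d(x,z)-d(y,z)\big)$, one has $(x,z)_w\ge\min\big((x,y)_w,(y,z)_w\big)-\delta$ for all $x,y,z,w\in X$. Write $B_r(x):=\{y\in X: d(x,y)<r\}$, and let $\mu$ be a Borel measure on $X$ such that - $\mu$ is locally doubling: $0<\mu(B_r(x))<\infty$ for all $x\in X$ and $r>0$, and for every $s>0$ there is a constant $L_s$ such that $\mu(B_{2r}(x))\le L_s\,\mu(B_r(x))$ for all $x\in X$ and $0<r\le s$; - $\mu$ has $(a,b)$-pinched exponential growth at infinity: there are constants $c,C>0$ such that $c\,a^r\le\mu(B_r(x))\le C\,b^r$ for all $x\in X$ and all $r\ge 1$. Let $\mathcal M f(x):=\sup_{r>0}\frac1{\mu(B_r(x))}\int_{B_r(x)}|f|\,d\mu$ be the centred Hardy–Littlewood maximal operator. Then: 1.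 for every $p\in(\tau,\infty]$, $\mathcal M$ is bounded on $L^p(X)$, that is, there is a constant $K$ such that for every $f\in L^p(X)$ the function $\mathcal M f$ is $\mu$-measurable and $\|\mathcal M f\|_{L^p(X)}\le K\,\|f\|_{L^p(X)}$; 2. $\mathcal M$ is of weak type $(\tau,\tau)$, that is, there is a constant $K$ such that for every $f\in L^\tau(X)$ the function $\mathcal M f$ is $\mu$-measurable and $\mu(\{x\in X:\mathcal M f(x)>\alpha\})\le K\,\alpha^{-\tau}\,\|f\|_{L^\tau(X)}^\tau$ for all $\alpha>0$. -/

import Mathlib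

open MeasureTheory Set
open scoped ENNReal NNReal

/-- `(X, d)` is a length space with strictly intrinsic metric: any two points are joined by a
continuous path whose length (total variation) equals their distance. -/
def IsStrictlyIntrinsic (X : Type*) [MetricSpace X] : Prop :=
  ∀ x y : X, ∃ γ : Path x y, eVariationOn (fun t : unitInterval => γ t) univ = edist x y

/-- The Gromov product `(y, z)_x`. -/
noncomputable def gromovProduct {X : Type*} [MetricSpace X] (x y z : X) : ℝ :=
  (dist x y + dist x z - dist y z) / 2

/-- The four points condition with constant `δ`. -/
def IsGromovHyperbolic (X : Type*) [MetricSpace X] (δ : ℝ) : Prop :=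
  ∀ x y z w : X,
    min (gromovProduct w x y) (gromovProduct w y z) - δ ≤ gromovProduct w x z

/-- All balls have positive finite measure, and for every `s > 0` there is a doubling constant
`L` valid for all balls of radius at most `s`. -/
structure IsLocallyDoubling {X : Type*} [MetricSpace X] [MeasurableSpace X]
    (μ : Measure X) : Prop where
  ball_pos : ∀ (x : X) (r : ℝ), 0 < r → 0 < μ (Metric.ball x r)
  ball_lt_top : ∀ (x : X) (r : ℝ), 0 < r → μ (Metric.ball x r) < ∞
  doubling : ∀ s : ℝ, 0 < s → ∃ L : ℝ≥0, ∀ (x : X) (r : ℝ), 0 < r → r ≤ s →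
    μ (Metric.ball x (2 * r)) ≤ L * μ (Metric.ball x r)

/-- `(a, b)`-pinched exponential growth at infinity. -/
def HasPinchedExpGrowth {X : Type*} [MetricSpace X] [MeasurableSpace X]
    (μ : Measure X) (a b : ℝ) : Prop :=
  ∃ c C : ℝ, 0 < c ∧ 0 < C ∧ ∀ (x : X) (r : ℝ), 1 ≤ r →
    ENNReal.ofReal (c * a ^ r) ≤ μ (Metric.ball x r) ∧
      μ (Metric.ball x r) ≤ ENNReal.ofReal (C * b ^ r)

/-- The centred Hardy–Littlewood maximal function, with values in `[0, ∞]`. -/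
noncomputable def maximalFunction {X : Type*} [MetricSpace X] [MeasurableSpace X]
    (μ : Measure X) (f : X → ℂ) (x : X) : ℝ≥0∞ :=
  ⨆ (r : ℝ) (_ : 0 < r),
    (μ (Metric.ball x r))⁻¹ * ∫⁻ y in Metric.ball x r, ‖f y‖ₑ ∂μ

/-- `T` is bounded on `L^p(μ)`, where `p ∈ (0, ∞]`. -/
def IsBoundedOnLp {X : Type*} [MeasurableSpace X] (μ : Measure X)
    (T : (X → ℂ) → X → ℝ≥0∞) (p : ℝ≥0∞) : Prop :=
  ∃ K : ℝ≥0, ∀ f : X → ℂ, MemLp f p μ →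
    AEMeasurable (T f) μ ∧ eLpNorm (T f) p μ ≤ K * eLpNorm f p μ

/-- `T` is of weak type `(p, p)`, where `0 < p < ∞`. -/
def IsWeakType {X : Type*} [MeasurableSpace X] (μ : Measure X)
    (T : (X → ℂ) → X → ℝ≥0∞) (p : ℝ) : Prop :=
  ∃ K : ℝ≥0, ∀ f : X → ℂ, MemLp f (ENNReal.ofReal p) μ →
    AEMeasurable (T f) μ ∧
      ∀ α : ℝ≥0, 0 < α →
        μ {x | (α : ℝ≥0∞) < T f x} ≤ K * (eLpNorm f (ENNReal.ofReal p) μ / α) ^ p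

/-! ### Measurability of averages over balls, and the local maximal operator. -/

section Balls

variable {X : Type*} [MetricSpace X] [MeasurableSpace X]

/-! Radii `r ≤ 1` are classical: Vitali covering and local doubling give weak type `(1, 1)`, and
Jensen's inequality turns this into weak type `(τ, τ)` (`weakType_local`). The substance is
`weakType_global`, for radii `r ≥ 1`.

Fix a base point `o` and compare distances to `o`. In a hyperbolic length space, the points `y` of
`B(x, n)` with `d(o, y) ≤ d(o, x) + s` lie in a ball of radius about `(n + s) / 2`, hence have
measure `≲ b ^ ((n + s) / 2)`. As `s` varies, this splits the kernel `1_{d(x, y) < n}` into a piece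
with sections at `x` of measure `≲ ρ` and a piece with sections at `y` of measure `≲ b ^ n / ρ`,
with `ρ > 0` free (`exists_kernel_splitting`). For `0 ≤ u ≤ 1`, let `ρ` depend on the dyadic level
of `u`. The first pieces then add up to a small constant, and the second are estimated in `L¹`; the
outcome is `μ {A < ∫_{B(x, n)} u} ≲ b ^ n ∫ u ^ q` for `1 < q < 2`
(`exists_measure_lintegral_ball_le`).

If an average of `F` over `B(x, r)` exceeds `t` and `n = ⌈r⌉`, the lower volume bound gives `∫_{B(x,
n)} F ≳ t a ^ n`. Replace `F` by its unit-scale average `g`. Either `g > t a ^ n` somewhere near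
`x`, and the set of such `x` is controlled by thickening a superlevel set, at the cost of a factor
`b ^ n`; or the estimate above applies to `u = g / (t a ^ n)`. Since `b = a ^ τ`, both bounds sum
over `n` to `∫ (g / t) ^ τ` up to passing to a slightly larger average, the second because `q > τ`.
The condition `b < a ^ 2` is exactly what leaves room for `τ < q < 2`.

The strong bounds for `p > τ` follow by interpolation with the trivial `L^∞` bound. -/

theorem measure_ball_le_iSup_rat (ν : Measure X) (x : X) (r : ℝ) :
    ν (Metric.ball x r) ≤ ⨆ (q : ℚ) (_ : 0 < (q : ℝ) ∧ (q : ℝ) < r), ν (Metric.ball x q) := by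
  rcases le_or_gt r 0 with hr | hr
  · simp [Metric.ball_eq_empty.2 hr]
  have hU : Metric.ball x r = ⋃ n : ℕ, Metric.ball x (r - 1 / ((n : ℝ) + 1)) := by
    ext y
    simp only [Metric.mem_ball, mem_iUnion]
    constructor
    · intro h
      obtain ⟨n, hn⟩ := exists_nat_one_div_lt (sub_pos.2 h)
      exact ⟨n, by linarith⟩
    · rintro ⟨n, hn⟩
      have : 0 < 1 / ((n : ℝ) + 1) := by positivity
      linarith
  rw [hU, Monotone.measure_iUnion]
  · refine iSup_le fun n => ?_
    have hn : 0 < 1 / ((n : ℝ) + 1) := by positivity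
    obtain ⟨q, hq1, hq2⟩ := exists_rat_btwn (show max 0 (r - 1 / ((n : ℝ) + 1)) < r by
      simp only [max_lt_iff]; exact ⟨hr, by linarith⟩)
    rw [max_lt_iff] at hq1
    exact (measure_mono (Metric.ball_subset_ball hq1.2.le)).trans
      (le_iSup₂_of_le q ⟨hq1.1, hq2⟩ le_rfl)
  · intro m n hmn
    refine Metric.ball_subset_ball ?_
    have := Nat.one_div_le_one_div (α := ℝ) hmn
    linarith

/-- Moving the centre by less than `r - q` keeps `B(x, q)` inside the ball of radius `r`, and the
smaller balls exhaust the measure because balls are open. -/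
theorem lowerSemicontinuous_measure_ball (ν : Measure X) (r : ℝ) :
    LowerSemicontinuous fun x => ν (Metric.ball x r) := by
  intro x t ht
  have h := lt_of_lt_of_le ht (measure_ball_le_iSup_rat ν x r)
  simp only [lt_iSup_iff] at h
  obtain ⟨q, ⟨-, hq⟩, hlt⟩ := h
  filter_upwards [Metric.ball_mem_nhds x (sub_pos.2 hq)] with y hy
  refine hlt.trans_le (measure_mono (Metric.ball_subset_ball' ?_))
  rw [Metric.mem_ball, dist_comm] at hy
  linarith

theorem measurable_measure_ball [BorelSpace X] (ν : Measure X) (r : ℝ) :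
    Measurable fun x => ν (Metric.ball x r) :=
  (lowerSemicontinuous_measure_ball ν r).measurable

theorem measurable_lintegral_ball [BorelSpace X] (μ : Measure X) (F : X → ℝ≥0∞) (r : ℝ) :
    Measurable fun x => ∫⁻ y in Metric.ball x r, F y ∂μ := by
  have := measurable_measure_ball (μ.withDensity F) r
  simpa only [withDensity_apply _ Metric.isOpen_ball.measurableSet] using this

/-- The mean of `F` over the ball with centre `x` and radius `r`. -/
noncomputable def ballAverage (μ : Measure X) (r : ℝ) (F : X → ℝ≥0∞) (x : X) : ℝ≥0∞ :=
  (μ (Metric.ball x r))⁻¹ * ∫⁻ y in Metric.ball x r, F y ∂μ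

/-- The centred maximal function of a nonnegative function. -/
noncomputable def ballMaximal (μ : Measure X) (F : X → ℝ≥0∞) (x : X) : ℝ≥0∞ :=
  ⨆ (r : ℝ) (_ : 0 < r), ballAverage μ r F x

theorem measurable_ballAverage [BorelSpace X] (μ : Measure X) (F : X → ℝ≥0∞) (r : ℝ) :
    Measurable (ballAverage μ r F) :=
  (measurable_measure_ball μ r).inv.mul (measurable_lintegral_ball μ F r)

/-- Shrinking the radius to a rational `q < r` only increases the factor `μ(B)⁻¹`, while the
integral is recovered in the limit. The supremum becomes countable, hence measurable. -/
theorem ballMaximal_eq_iSup_rat [BorelSpace X] (μ : Measure X) (F : X → ℝ≥0∞) (x : X) :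
    ballMaximal μ F x = ⨆ (q : ℚ) (_ : 0 < (q : ℝ)), ballAverage μ q F x := by
  apply le_antisymm
  · refine iSup₂_le fun r hr => ?_
    have h := measure_ball_le_iSup_rat (μ.withDensity F) x r
    simp only [withDensity_apply _ Metric.isOpen_ball.measurableSet] at h
    calc ballAverage μ r F x ≤ (μ (Metric.ball x r))⁻¹ *
          ⨆ (q : ℚ) (_ : 0 < (q : ℝ) ∧ (q : ℝ) < r), ∫⁻ y in Metric.ball x q, F y ∂μ := by
            unfold ballAverage; gcongr
      _ ≤ _ := by
        simp only [ENNReal.mul_iSup]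
        refine iSup₂_le fun q hq => le_iSup₂_of_le q hq.1 ?_
        unfold ballAverage
        gcongr
        exact hq.2.le
  · exact iSup₂_le fun q hq => le_iSup₂_of_le (q : ℝ) hq le_rfl

theorem measurable_ballMaximal [BorelSpace X] (μ : Measure X) (F : X → ℝ≥0∞) :
    Measurable (ballMaximal μ F) := by
  have : ballMaximal μ F = fun x => ⨆ (q : ℚ) (_ : 0 < (q : ℝ)), ballAverage μ q F x :=
    funext (ballMaximal_eq_iSup_rat μ F)
  rw [this]
  exact Measurable.iSup fun q => Measurable.iSup fun _ => measurable_ballAverage μ F q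

theorem IsLocallyDoubling.sigmaFinite {μ : Measure X} (h : IsLocallyDoubling μ) :
    SigmaFinite μ := by
  rcases isEmpty_or_nonempty X with hX | ⟨⟨o⟩⟩
  · have : μ = 0 := Measure.eq_zero_of_isEmpty μ
    rw [this]; infer_instance
  · refine ⟨⟨⟨fun n : ℕ => Metric.ball o ((n : ℝ) + 1), fun _ => trivial,
      fun n => h.ball_lt_top o _ (by positivity), ?_⟩⟩⟩
    refine eq_univ_of_forall fun x => mem_iUnion.2 ?_
    obtain ⟨n, hn⟩ := exists_nat_gt (dist x o)
    exact ⟨n, by rw [Metric.mem_ball]; linarith⟩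

theorem IsLocallyDoubling.countable_of_pairwiseDisjoint [BorelSpace X] {μ : Measure X} (h : IsLocallyDoubling μ)
    {ι : Type*} {u : Set ι} {c : ι → X} {r : ι → ℝ} (hr : ∀ i ∈ u, 0 < r i)
    (hd : u.PairwiseDisjoint fun i => Metric.closedBall (c i) (r i)) : u.Countable := by
  have := h.sigmaFinite
  have hc := Measure.countable_meas_pos_of_disjoint_iUnion (μ := μ)
    (As := fun i : u => Metric.ball (c i) (r i)) (fun i => Metric.isOpen_ball.measurableSet)
    (fun i j hij => (hd i.2 j.2 (fun e => hij (Subtype.ext e))).mono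
      Metric.ball_subset_closedBall Metric.ball_subset_closedBall)
  have : {i : u | 0 < μ (Metric.ball (c i) (r i))} = univ :=
    eq_univ_of_forall fun i => h.ball_pos _ _ (hr i i.2)
  rw [this] at hc
  exact countable_coe_iff.1 (countable_univ_iff.1 hc)

/-- Disjoint balls of positive measure in a σ-finite space are countably many, and the centres of a
maximal-type Vitali family of small balls form a net. Second countability is needed for product
measurability in the Fubini arguments. -/
theorem IsLocallyDoubling.secondCountableTopology [BorelSpace X] {μ : Measure X} (h : IsLocallyDoubling μ) :
    SecondCountableTopology X := by
  refine Metric.secondCountable_of_almost_dense_set fun ε hε => ?_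
  obtain ⟨u, -, hd, hcov⟩ := Vitali.exists_disjoint_subfamily_covering_enlargement_closedBall
    (univ : Set X) id (fun _ => ε / 5) (ε / 5) (fun _ _ => le_rfl) 5 (by norm_num)
  refine ⟨u, h.countable_of_pairwiseDisjoint (fun _ _ => by positivity) hd, fun x => ?_⟩
  obtain ⟨y, hy, hxy⟩ := hcov x trivial
  refine ⟨y, hy, ?_⟩
  have := hxy (Metric.mem_closedBall_self (by positivity))
  rw [Metric.mem_closedBall] at this
  simp only [id] at this
  linarith

theorem ballAverage_rpow_le {μ : Measure X} (h : IsLocallyDoubling μ) {p r : ℝ} (hp : 1 ≤ p)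
    (hr : 0 < r) {F : X → ℝ≥0∞} (hF : Measurable F) (x : X) :
    ballAverage μ r F x ^ p ≤ ballAverage μ r (fun y => F y ^ p) x := by
  have key : ∀ G : X → ℝ≥0∞, ballAverage μ r G x =
      ∫⁻ y, G y ∂((μ (Metric.ball x r))⁻¹ • μ.restrict (Metric.ball x r)) := fun G => by
    rw [lintegral_smul_measure]; rfl
  have : IsProbabilityMeasure ((μ (Metric.ball x r))⁻¹ • μ.restrict (Metric.ball x r)) :=
    ⟨by simp [ENNReal.inv_mul_cancel (h.ball_pos x r hr).ne' (h.ball_lt_top x r hr).ne]⟩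
  rw [key, key]
  have h0 : 0 < p := by linarith
  have hJ := eLpNorm_le_eLpNorm_of_exponent_le (p := 1) (q := ENNReal.ofReal p) (by simpa using hp)
    (hF.aestronglyMeasurable (μ := (μ (Metric.ball x r))⁻¹ • μ.restrict (Metric.ball x r)))
  rw [eLpNorm_one_eq_lintegral_enorm, eLpNorm_eq_lintegral_rpow_enorm_toReal (by simpa using h0)
    ENNReal.ofReal_ne_top, ENNReal.toReal_ofReal h0.le] at hJ
  have := ENNReal.rpow_le_rpow hJ h0.le
  rw [← ENNReal.rpow_mul, one_div_mul_cancel h0.ne', ENNReal.rpow_one] at this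
  simpa only [enorm_eq_self] using this

/-- Fubini for the symmetric kernel `1_{d(y, z) < r}`. -/
theorem lintegral_mul_lintegral_ball [BorelSpace X] [SecondCountableTopology X] (μ : Measure X) [SFinite μ]
    {w F : X → ℝ≥0∞} (hw : Measurable w) (hF : Measurable F) (r : ℝ) :
    ∫⁻ y, w y * ∫⁻ z in Metric.ball y r, F z ∂μ ∂μ =
      ∫⁻ z, F z * ∫⁻ y in Metric.ball z r, w y ∂μ ∂μ := by
  have hS : MeasurableSet {p : X × X | dist p.1 p.2 < r} :=
    (isOpen_lt (continuous_fst.dist continuous_snd) continuous_const).measurableSet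
  have e1 : ∀ y, w y * ∫⁻ z in Metric.ball y r, F z ∂μ =
      ∫⁻ z, {p : X × X | dist p.1 p.2 < r}.indicator (fun p => w p.1 * F p.2) (y, z) ∂μ := by
    intro y
    rw [← lintegral_const_mul _ hF, ← lintegral_indicator Metric.isOpen_ball.measurableSet]
    refine lintegral_congr fun z => ?_
    simp [indicator, Metric.mem_ball, dist_comm]
  have e2 : ∀ z, F z * ∫⁻ y in Metric.ball z r, w y ∂μ =
      ∫⁻ y, {p : X × X | dist p.1 p.2 < r}.indicator (fun p => w p.1 * F p.2) (y, z) ∂μ := by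
    intro z
    rw [← lintegral_const_mul _ hw, ← lintegral_indicator Metric.isOpen_ball.measurableSet]
    refine lintegral_congr fun y => ?_
    simp [indicator, Metric.mem_ball, mul_comm]
  simp only [e1, e2]
  refine lintegral_lintegral_swap (f := fun y z =>
    {p : X × X | dist p.1 p.2 < r}.indicator (fun p => w p.1 * F p.2) (y, z)) ?_
  exact (((hw.comp measurable_fst).mul (hF.comp measurable_snd)).indicator hS).aemeasurable

/-- The doubling inequality for all radii at most `s`, with a positive constant. -/
theorem IsLocallyDoubling.exists_pos {μ : Measure X} (h : IsLocallyDoubling μ) {s : ℝ}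
    (hs : 0 < s) : ∃ L : ℝ≥0, 0 < L ∧ ∀ (x : X) (r : ℝ), 0 < r → r ≤ s →
      μ (Metric.ball x (2 * r)) ≤ L * μ (Metric.ball x r) := by
  obtain ⟨L, hL⟩ := h.doubling s hs
  refine ⟨L + 1, by positivity, fun x r h0 hr => (hL x r h0 hr).trans ?_⟩
  gcongr
  exact le_self_add

theorem weakType_one_local [BorelSpace X] {μ : Measure X} (h : IsLocallyDoubling μ) :
    ∃ K : ℝ≥0, ∀ (F : X → ℝ≥0∞) (t : ℝ≥0∞), t ≠ 0 → t ≠ ∞ →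
      μ {x | ∃ r, 0 < r ∧ r ≤ 1 ∧ t < ballAverage μ r F x} ≤ K * (∫⁻ x, F x ∂μ) / t := by
  -- The Vitali enlargement by `5` fits in the open ball of radius `8r`, reached by doubling `r`,
  -- `2r`, `4r`; all of these are at most `4`.
  obtain ⟨L, hL0, hL⟩ := h.exists_pos (s := 4) (by norm_num)
  refine ⟨L ^ 3, fun F t ht0 ht => ?_⟩
  set T : Set (X × ℝ) := {p | 0 < p.2 ∧ p.2 ≤ 1 ∧ t < ballAverage μ p.2 F p.1}
  obtain ⟨u, hu, hd, hcov⟩ := Vitali.exists_disjoint_subfamily_covering_enlargement_closedBall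
    T Prod.fst Prod.snd 1 (fun p hp => hp.2.1) 5 (by norm_num)
  have huc : u.Countable := h.countable_of_pairwiseDisjoint (fun p hp => (hu hp).1) hd
  have : Countable u := huc
  have hsub : {x | ∃ r, 0 < r ∧ r ≤ 1 ∧ t < ballAverage μ r F x} ⊆
      ⋃ p : u, Metric.ball p.1.1 (2 * (2 * (2 * p.1.2))) := by
    rintro x ⟨r, hr0, hr1, hx⟩
    obtain ⟨p, hp, hsub⟩ := hcov (x, r) ⟨hr0, hr1, hx⟩
    refine mem_iUnion.2 ⟨⟨p, hp⟩, ?_⟩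
    have h1 := hsub (Metric.mem_closedBall_self hr0.le)
    have h2 : 0 < p.2 := (hu hp).1
    simp only [Metric.mem_closedBall, Metric.mem_ball] at h1 ⊢
    linarith
  have hball : ∀ p : u, μ (Metric.ball p.1.1 (2 * (2 * (2 * p.1.2)))) ≤
      (L : ℝ≥0∞) ^ 3 / t * ∫⁻ y in Metric.ball p.1.1 p.1.2, F y ∂μ := by
    intro p
    obtain ⟨h0, h1, h2⟩ := hu p.2
    have hpos := h.ball_pos p.1.1 p.1.2 h0
    have hfin := h.ball_lt_top p.1.1 p.1.2 h0
    have h3 : μ (Metric.ball p.1.1 p.1.2) ≤ (∫⁻ y in Metric.ball p.1.1 p.1.2, F y ∂μ) / t := by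
      rw [ENNReal.le_div_iff_mul_le (Or.inl ht0) (Or.inl ht)]
      calc μ (Metric.ball p.1.1 p.1.2) * t
          ≤ μ (Metric.ball p.1.1 p.1.2) * ballAverage μ p.1.2 F p.1.1 := by gcongr
        _ = _ := by
          unfold ballAverage
          rw [← mul_assoc, ENNReal.mul_inv_cancel hpos.ne' hfin.ne, one_mul]
    calc μ (Metric.ball p.1.1 (2 * (2 * (2 * p.1.2))))
        ≤ L * (L * (L * μ (Metric.ball p.1.1 p.1.2))) := by
          refine (hL _ _ (by linarith) (by linarith)).trans ?_
          gcongr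
          refine (hL _ _ (by linarith) (by linarith)).trans ?_
          gcongr
          exact hL _ _ (by linarith) (by linarith)
      _ ≤ L * (L * (L * ((∫⁻ y in Metric.ball p.1.1 p.1.2, F y ∂μ) / t))) := by gcongr
      _ = _ := by simp only [div_eq_mul_inv]; ring
  calc _ ≤ μ (⋃ p : u, Metric.ball p.1.1 (2 * (2 * (2 * p.1.2)))) := measure_mono hsub
    _ ≤ ∑' p : u, μ (Metric.ball p.1.1 (2 * (2 * (2 * p.1.2)))) := measure_iUnion_le _
    _ ≤ ∑' p : u, (L : ℝ≥0∞) ^ 3 / t * ∫⁻ y in Metric.ball p.1.1 p.1.2, F y ∂μ :=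
        ENNReal.tsum_le_tsum hball
    _ = (L : ℝ≥0∞) ^ 3 / t * ∫⁻ y in ⋃ p : u, Metric.ball p.1.1 p.1.2, F y ∂μ := by
        rw [ENNReal.tsum_mul_left, lintegral_iUnion (fun p => Metric.isOpen_ball.measurableSet)]
        exact fun i j hij => (hd i.2 j.2 (fun e => hij (Subtype.ext e))).mono
          Metric.ball_subset_closedBall Metric.ball_subset_closedBall
    _ ≤ (L : ℝ≥0∞) ^ 3 / t * ∫⁻ y, F y ∂μ := by gcongr; exact Measure.restrict_le_self
    _ = _ := by push_cast; simp only [div_eq_mul_inv]; ring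

/-- By Jensen, an average of `F` above `t` forces the average of `F ^ p` above `t ^ p`, so the weak
`(1, 1)` bound applies to `F ^ p`. -/
theorem weakType_local [BorelSpace X] {μ : Measure X} (h : IsLocallyDoubling μ) {p : ℝ} (hp : 1 ≤ p) :
    ∃ K : ℝ≥0, ∀ (F : X → ℝ≥0∞), Measurable F → ∀ t : ℝ≥0∞, t ≠ 0 → t ≠ ∞ →
      μ {x | ∃ r, 0 < r ∧ r ≤ 1 ∧ t < ballAverage μ r F x} ≤
        K * (∫⁻ x, F x ^ p ∂μ) / t ^ p := by
  obtain ⟨K, hK⟩ := weakType_one_local h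
  refine ⟨K, fun F hF t ht0 ht => ?_⟩
  have h0 : 0 < p := by linarith
  refine (measure_mono ?_).trans (hK (fun x => F x ^ p) (t ^ p)
    (by simp [ht0, ht]) (by simp [ht0, ht]))
  rintro x ⟨r, hr0, hr1, hx⟩
  exact ⟨r, hr0, hr1, (ENNReal.rpow_lt_rpow hx h0).trans_le (ballAverage_rpow_le h hp hr0 hF x)⟩

end Balls

/-! ### Hyperbolic geometry: balls cut by the distance to a base point. -/

section Hyperbolic

variable {X : Type*} [MetricSpace X]

/-- The intermediate value theorem picks a point on a shortest path; additivity of length along the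
path forces equality in the triangle inequality. -/
theorem IsStrictlyIntrinsic.exists_dist_eq (h : IsStrictlyIntrinsic X) (x y : X) {t : ℝ}
    (ht0 : 0 ≤ t) (ht : t ≤ dist x y) : ∃ w, dist x w = t ∧ dist w y = dist x y - t := by
  obtain ⟨γ, hγ⟩ := h x y
  have hc : Continuous fun s : unitInterval => dist x (γ s) := by fun_prop
  have hmem : t ∈ Icc (dist x (γ 0)) (dist x (γ 1)) := by simpa using ⟨ht0, ht⟩
  obtain ⟨s, hs⟩ := mem_range_of_exists_le_of_exists_ge hc ⟨0, hmem.1⟩ ⟨1, hmem.2⟩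
  refine ⟨γ s, hs, ?_⟩
  have h1 := eVariationOn.edist_le (fun t : unitInterval => γ t)
    (s := univ ∩ Icc 0 s) (x := 0) (y := s) (by simp) (by simp)
  have h2 := eVariationOn.edist_le (fun t : unitInterval => γ t)
    (s := univ ∩ Icc s 1) (x := s) (y := 1) (by simp [unitInterval.le_one']) (by simp [unitInterval.le_one'])
  have h3 := eVariationOn.Icc_add_Icc (fun t : unitInterval => γ t) (s := univ) (a := 0) (b := s)
    (c := 1) (by simp) unitInterval.le_one' trivial
  have h4 : eVariationOn (fun t : unitInterval => γ t) (univ ∩ Icc 0 1) ≤ edist x y := by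
    rw [← hγ]; exact eVariationOn.mono _ inter_subset_left
  have h5 : edist x (γ s) + edist (γ s) y ≤ edist x y := by
    refine le_trans ?_ (h3 ▸ h4)
    simpa using add_le_add h1 h2
  simp only [edist_dist] at h5
  rw [← ENNReal.ofReal_add dist_nonneg dist_nonneg, ENNReal.ofReal_le_ofReal_iff dist_nonneg] at h5
  have := dist_triangle x (γ s) y
  simp only at hs
  linarith

/-- In a hyperbolic length space, the points of a ball about `x` which are not much further from
the base point `o` than `x` lie in a much smaller ball. -/
theorem IsGromovHyperbolic.exists_ball_supset {δ : ℝ} (hδ : 0 ≤ δ)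
    (hhyp : IsGromovHyperbolic X δ) (hlen : IsStrictlyIntrinsic X) (o x : X) {n s : ℝ}
    (hns : s ≤ n) :
    ∃ w, {y | dist x y < n ∧ dist o y ≤ dist o x + s} ⊆
      Metric.ball w ((n + s) / 2 + 2 * δ + 1) := by
  -- The centre `w` lies between `o` and `x` at distance `(n - s) / 2` from `x`, or is `o` itself if
  -- that overshoots. With base point `o` one has `(w, x)_o = t`, and either value of the minimum in
  -- the four points condition yields `d(w, y) ≤ (n + s) / 2 + 2δ`.
  have main : ∀ t, 0 ≤ t → t ≤ dist o x → (2 * dist o x + s - n) / 2 ≤ t →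
      (t ≤ (2 * dist o x + s - n) / 2 ∨ t = 0) →
      ∃ w, {y | dist x y < n ∧ dist o y ≤ dist o x + s} ⊆
        Metric.ball w ((n + s) / 2 + 2 * δ + 1) := by
    intro t ht0 ht hg hg'
    obtain ⟨w, hw1, hw2⟩ := hlen.exists_dist_eq o x ht0 ht
    refine ⟨w, ?_⟩
    rintro y ⟨hy1, hy2⟩
    rw [Metric.mem_ball, dist_comm]
    have h4 := hhyp w x y o
    simp only [gromovProduct] at h4
    have hxy := dist_triangle o x y
    have hox := dist_triangle o y x
    rw [dist_comm y x] at hox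
    have hwy := dist_triangle o w y
    have hyx := dist_triangle w o y
    rw [dist_comm w o] at hyx
    rcases hg' with h | h
    · rcases min_cases ((dist o w + dist o x - dist w x) / 2)
        ((dist o x + dist o y - dist x y) / 2) with ⟨e, -⟩ | ⟨e, -⟩ <;> rw [e] at h4 <;> linarith
    · linarith
  rcases le_total ((2 * dist o x + s - n) / 2) 0 with h | h
  · exact main 0 le_rfl dist_nonneg h (Or.inr rfl)
  · exact main _ h (by linarith) le_rfl (Or.inl le_rfl)

variable [MeasurableSpace X]

theorem measure_inter_horoball_le {μ : Measure X} {δ : ℝ} (hδ : 0 ≤ δ)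
    (hhyp : IsGromovHyperbolic X δ) (hlen : IsStrictlyIntrinsic X) {b C : ℝ} (hb : 1 < b)
    (hvol : ∀ (x : X) (r : ℝ), 1 ≤ r → μ (Metric.ball x r) ≤ ENNReal.ofReal (C * b ^ r))
    (o x : X) (n s : ℝ) :
    μ {y | dist x y < n ∧ dist o y ≤ dist o x + s} ≤
      ENNReal.ofReal (C * b ^ (2 * δ + 1) * b ^ ((n + s) / 2)) := by
  have hb0 : 0 < b := by linarith
  rcases lt_or_ge (n + s) 0 with hneg | hpos
  · have : {y | dist x y < n ∧ dist o y ≤ dist o x + s} = ∅ := by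
      refine eq_empty_of_forall_notMem ?_
      rintro y ⟨h1, h2⟩
      have := dist_triangle o y x
      rw [dist_comm y x] at this
      linarith
    simp [this]
  · have hcase : ∃ w, {y | dist x y < n ∧ dist o y ≤ dist o x + s} ⊆
        Metric.ball w ((n + s) / 2 + 2 * δ + 1) := by
      rcases le_total s n with h | h
      · exact hhyp.exists_ball_supset hδ hlen o x h
      · refine ⟨x, fun y hy => ?_⟩
        rw [Metric.mem_ball, dist_comm]
        linarith [hy.1]
    obtain ⟨w, hw⟩ := hcase
    -- The summand `1` in the radius makes it at least `1`, as the volume bound requires.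
    refine (measure_mono hw).trans ((hvol _ _ (by linarith)).trans ?_)
    rw [mul_assoc, ← Real.rpow_add hb0]
    refine ENNReal.ofReal_le_ofReal (le_of_eq ?_)
    ring_nf

/-- Splitting of the kernel `1_{d(x, y) < n}` into two pieces, one with small sections at `x`, one
with small sections at `y`. -/
theorem exists_kernel_splitting [BorelSpace X] [SecondCountableTopology X] {μ : Measure X} {δ : ℝ} (hδ : 0 ≤ δ)
    (hhyp : IsGromovHyperbolic X δ) (hlen : IsStrictlyIntrinsic X) {b C : ℝ} (hb : 1 < b)
    (hC : 0 < C)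
    (hvol : ∀ (x : X) (r : ℝ), 1 ≤ r → μ (Metric.ball x r) ≤ ENNReal.ofReal (C * b ^ r))
    (o : X) :
    ∃ K : ℝ≥0, 0 < K ∧ ∀ (n : ℕ) (ρ : ℝ≥0), 0 < ρ → ∃ S : Set (X × X), MeasurableSet S ∧
      (∀ x, μ {y | dist x y < n ∧ (x, y) ∈ S} ≤ K * ρ) ∧
      ∀ y, μ {x | dist x y < n ∧ (x, y) ∉ S} ≤ K * ENNReal.ofReal b ^ n / ρ := by
  have hb0 : 0 < b := by linarith
  have hK : 0 < C * b ^ (2 * δ + 1) := by positivity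
  refine ⟨(C * b ^ (2 * δ + 1)).toNNReal, Real.toNNReal_pos.2 hK, fun n ρ hρ => ?_⟩
  have hρ' : (0 : ℝ) < ρ := hρ
  have e1 : b ^ (Real.logb b ρ) = (ρ : ℝ) := Real.rpow_logb hb0 hb.ne' hρ'
  have eK : (((C * b ^ (2 * δ + 1)).toNNReal : ℝ≥0) : ℝ≥0∞) =
      ENNReal.ofReal (C * b ^ (2 * δ + 1)) := rfl
  -- The shift `s = 2 log_b ρ - n` makes `b ^ ((n + s) / 2) = ρ`. Off this set the roles of `x` and
  -- `y` are exchanged and `s` becomes `-s`, which gives `b ^ n / ρ`.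
  refine ⟨{p | dist o p.2 ≤ dist o p.1 + (2 * Real.logb b ρ - n)},
    (isClosed_le (by fun_prop) (by fun_prop)).measurableSet, fun x => ?_, fun y => ?_⟩
  · refine (measure_inter_horoball_le hδ hhyp hlen hb hvol o x n _).trans (le_of_eq ?_)
    rw [show ((n : ℝ) + (2 * Real.logb b ρ - n)) / 2 = Real.logb b ρ by ring, e1, eK,
      ENNReal.ofReal_mul hK.le, ENNReal.ofReal_coe_nnreal]
  · have hsub : {x | dist x y < n ∧
        (x, y) ∉ {p : X × X | dist o p.2 ≤ dist o p.1 + (2 * Real.logb b ρ - n)}} ⊆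
        {x | dist y x < n ∧ dist o x ≤ dist o y + (n - 2 * Real.logb b ρ)} := by
      rintro x ⟨h1, h2⟩
      simp only [mem_ofPred_eq] at h2
      refine ⟨by rwa [dist_comm], by linarith⟩
    refine (measure_mono hsub).trans
      ((measure_inter_horoball_le hδ hhyp hlen hb hvol o y n _).trans (le_of_eq ?_))
    rw [show ((n : ℝ) + (n - 2 * Real.logb b ρ)) / 2 = n - Real.logb b ρ by ring,
      Real.rpow_sub hb0, e1, Real.rpow_natCast, eK, ENNReal.ofReal_mul hK.le,
      ENNReal.ofReal_div_of_pos hρ', ENNReal.ofReal_coe_nnreal, ENNReal.ofReal_pow hb0.le,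
      mul_div_assoc]

end Hyperbolic

/-! ### Dyadic decomposition of the values in `(0, 1]`. -/

section Dyadic

/-- The dyadic shell `(2^{-(k+1)}, 2^{-k}]`. -/
def dyadicShell (k : ℕ) : Set ℝ≥0∞ := Ioc (2⁻¹ ^ (k + 1)) (2⁻¹ ^ k)

theorem dyadicShell_injective {v : ℝ≥0∞} {j k : ℕ} (hj : v ∈ dyadicShell j)
    (hk : v ∈ dyadicShell k) : j = k := by
  have key : ∀ {j k : ℕ}, v ∈ dyadicShell j → v ∈ dyadicShell k → ¬ j < k := by
    intro j k hj hk hlt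
    have : (2⁻¹ : ℝ≥0∞) ^ k ≤ 2⁻¹ ^ (j + 1) := pow_le_pow_right_of_le_one' (by simp) hlt
    exact absurd (hj.1.trans_le (hk.2.trans this)) (lt_irrefl _)
  exact le_antisymm (not_lt.1 (key hk hj)) (not_lt.1 (key hj hk))

theorem exists_mem_dyadicShell {v : ℝ≥0∞} (h0 : v ≠ 0) (h1 : v ≤ 1) : ∃ k, v ∈ dyadicShell k := by
  classical
  have hex : ∃ k : ℕ, (2⁻¹ : ℝ≥0∞) ^ (k + 1) < v := by
    have ht := (ENNReal.tendsto_pow_atTop_nhds_zero_of_lt_one (r := 2⁻¹) (by simp)).comp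
      (Filter.tendsto_add_atTop_nat 1)
    exact (ht.eventually (gt_mem_nhds (pos_iff_ne_zero.2 h0))).exists
  refine ⟨Nat.find hex, Nat.find_spec hex, ?_⟩
  rcases hk : Nat.find hex with _ | m
  · simpa using h1
  · exact not_lt.1 (Nat.find_min hex (hk ▸ Nat.lt_succ_self m))

theorem le_tsum_dyadicShell {v : ℝ≥0∞} (h1 : v ≤ 1) :
    v ≤ ∑' k, 2⁻¹ ^ k * (dyadicShell k).indicator 1 v := by
  rcases eq_or_ne v 0 with rfl | h0
  · exact bot_le
  obtain ⟨k, hk⟩ := exists_mem_dyadicShell h0 h1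
  refine le_trans ?_ (ENNReal.le_tsum k)
  simpa [indicator_of_mem hk] using hk.2

theorem tsum_dyadicShell_le {q : ℝ} (hq : 0 ≤ q) (v : ℝ≥0∞) :
    ∑' k, ((2⁻¹ : ℝ≥0∞) ^ q) ^ k * (dyadicShell k).indicator 1 v ≤ (2 * v) ^ q := by
  by_cases h : ∃ k, v ∈ dyadicShell k
  · obtain ⟨k, hk⟩ := h
    rw [tsum_eq_single k]
    · rw [indicator_of_mem hk, Pi.one_apply, mul_one, ← ENNReal.rpow_natCast, ← ENNReal.rpow_mul,
        mul_comm q, ENNReal.rpow_mul, ENNReal.rpow_natCast]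
      refine ENNReal.rpow_le_rpow ?_ hq
      calc (2⁻¹ : ℝ≥0∞) ^ k = 2 * 2⁻¹ ^ (k + 1) := by
            rw [pow_succ', ← mul_assoc, ENNReal.mul_inv_cancel (by simp) (by simp), one_mul]
        _ ≤ 2 * v := by gcongr; exact hk.1.le
    · intro j hj
      rw [indicator_of_notMem, mul_zero]
      exact fun hv => hj (dyadicShell_injective hv hk)
  · simp only [not_exists] at h
    simp [indicator_of_notMem (h _)]

end Dyadic

/-! ### The distributional estimate for integrals over large balls. -/

section Core

variable {X : Type*} [MetricSpace X] [MeasurableSpace X] [BorelSpace X]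
  [SecondCountableTopology X]

/-- On the shell `u ≈ 2 ^ (-k)` the kernel is split with `ρ = ε d ^ k`, where `d = 2 ^ (q - 1)`. As
`q < 2`, the sections at `x` contribute a convergent series, made at most `A / 2` by the choice of
`ε`. The rest must then be at least `A / 2`; Markov's inequality applies, with weights `2 ^ (-k) d ^
(-k) = 2 ^ (-qk)` that rebuild `∫ u ^ q`. -/
theorem exists_measure_lintegral_ball_le {μ : Measure X} [SFinite μ] {K : ℝ≥0} (hK : 0 < K)
    {B : ℝ≥0∞}
    (hsplit : ∀ (n : ℕ) (ρ : ℝ≥0), 0 < ρ → ∃ S : Set (X × X), MeasurableSet S ∧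
      (∀ x, μ {y | dist x y < n ∧ (x, y) ∈ S} ≤ K * ρ) ∧
      ∀ y, μ {x | dist x y < n ∧ (x, y) ∉ S} ≤ K * B ^ n / ρ)
    {q : ℝ} (hq1 : 1 < q) (hq2 : q < 2) {A : ℝ≥0} (hA : 0 < A) :
    ∃ K' : ℝ≥0, ∀ (n : ℕ) (u : X → ℝ≥0∞), Measurable u → (∀ x, u x ≤ 1) →
      μ {x | A < ∫⁻ y in Metric.ball x n, u y ∂μ} ≤ K' * B ^ n * ∫⁻ x, u x ^ q ∂μ := by
  set d : ℝ≥0 := 2 ^ (q - 1) with hd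
  have hd0 : 0 < d := NNReal.rpow_pos (by norm_num)
  have hr : d / 2 < 1 := by
    rw [div_lt_one (by norm_num)]
    calc d < 2 ^ (1 : ℝ) := NNReal.rpow_lt_rpow_of_exponent_lt (by norm_num) (by linarith)
      _ = 2 := by simp
  have hr' : 0 < 1 - d / 2 := tsub_pos_of_lt hr
  -- Exactly the value for which `∑ 2 ^ (-k) K ε d ^ k = A / 2`.
  obtain ⟨ε, hε0, hKε⟩ : ∃ ε : ℝ≥0, 0 < ε ∧ K * ε = A / 2 * (1 - d / 2) :=
    ⟨A / 2 * (1 - d / 2) / K, by positivity, by field_simp⟩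
  have hdq : (2⁻¹ : ℝ≥0∞) * (d : ℝ≥0∞)⁻¹ = 2⁻¹ ^ q := by
    rw [hd, ENNReal.coe_rpow_of_ne_zero (by norm_num), ENNReal.inv_rpow, ENNReal.coe_ofNat,
      ← ENNReal.mul_inv (by simp) (by simp)]
    congr 1
    nth_rw 1 [← ENNReal.rpow_one 2]
    rw [← ENNReal.rpow_add _ _ (by simp) (by simp)]
    congr 1; ring
  refine ⟨K / ε * 2 ^ q / (A / 2), fun n u hu hu1 => ?_⟩
  choose S hSm hS1 hS2 using fun k : ℕ => hsplit n (ε * d ^ k) (by positivity)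
  set V : ℕ → Set X := fun k => u ⁻¹' dyadicShell k
  have hV : ∀ k, MeasurableSet (V k) := fun k => hu measurableSet_Ioc
  set W : ℕ → Set (X × X) := fun k =>
    ({p | dist p.1 p.2 < n} ∩ (S k)ᶜ) ∩ Prod.snd ⁻¹' V k
  have hW : ∀ k, MeasurableSet (W k) := fun k =>
    (((isOpen_lt (continuous_fst.dist continuous_snd) continuous_const).measurableSet).inter
      (hSm k).compl).inter (measurable_snd (hV k))
  set I₁ : X → ℝ≥0∞ := fun x => ∑' k, 2⁻¹ ^ k * μ {y | dist x y < n ∧ (x, y) ∈ S k}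
  set I₂ : X → ℝ≥0∞ := fun x => ∑' k, 2⁻¹ ^ k * μ (Prod.mk x ⁻¹' W k)
  have hI₂m : Measurable I₂ :=
    Measurable.tsum fun k => (measurable_measure_prodMk_left (hW k)).const_mul _
  have hI₁ : ∀ x, I₁ x ≤ (A / 2 : ℝ≥0) := by
    intro x
    calc I₁ x ≤ ∑' k : ℕ, ((K * ε : ℝ≥0) : ℝ≥0∞) * ((d / 2 : ℝ≥0) : ℝ≥0∞) ^ k := by
          refine ENNReal.tsum_le_tsum fun k => ?_
          refine (mul_le_mul_right (hS1 k x) _).trans (le_of_eq ?_)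
          rw [ENNReal.coe_div (by norm_num)]
          push_cast
          rw [div_eq_mul_inv, mul_pow]; ring
      _ = ((K * ε : ℝ≥0) : ℝ≥0∞) * ((1 - d / 2 : ℝ≥0) : ℝ≥0∞)⁻¹ := by
          rw [ENNReal.tsum_mul_left, ENNReal.tsum_geometric, ENNReal.coe_sub, ENNReal.coe_one]
      _ = _ := by
          rw [hKε, ENNReal.coe_mul, mul_assoc, ENNReal.mul_inv_cancel (ENNReal.coe_ne_zero.2 hr'.ne')
            ENNReal.coe_ne_top, mul_one]
      _ ≤ _ := le_rfl
  have hI : ∀ x, ∫⁻ y in Metric.ball x n, u y ∂μ ≤ I₁ x + I₂ x := by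
    intro x
    calc ∫⁻ y in Metric.ball x n, u y ∂μ
        ≤ ∫⁻ y in Metric.ball x n, ∑' k, 2⁻¹ ^ k * (V k).indicator 1 y ∂μ :=
          lintegral_mono fun y => le_tsum_dyadicShell (hu1 y)
      _ = ∑' k, 2⁻¹ ^ k * μ (V k ∩ Metric.ball x n) := by
          rw [lintegral_tsum fun k => ((measurable_one.indicator (hV k)).const_mul _).aemeasurable]
          refine tsum_congr fun k => ?_
          rw [lintegral_const_mul _ (measurable_one.indicator (hV k)), lintegral_indicator_one (hV k),
            Measure.restrict_apply (hV k)]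
      _ ≤ ∑' k, (2⁻¹ ^ k * μ {y | dist x y < n ∧ (x, y) ∈ S k} +
            2⁻¹ ^ k * μ (Prod.mk x ⁻¹' W k)) := by
          refine ENNReal.tsum_le_tsum fun k => ?_
          rw [← mul_add]
          gcongr
          refine le_trans (measure_mono ?_) (measure_union_le _ _)
          rintro y ⟨hy1, hy2⟩
          rw [Metric.mem_ball, dist_comm] at hy2
          by_cases h : (x, y) ∈ S k
          · exact Or.inl ⟨hy2, h⟩
          · exact Or.inr ⟨⟨hy2, h⟩, hy1⟩
      _ = I₁ x + I₂ x := ENNReal.tsum_add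
  have hsub : {x | (A : ℝ≥0∞) < ∫⁻ y in Metric.ball x n, u y ∂μ} ⊆
      {x | ((A / 2 : ℝ≥0) : ℝ≥0∞) ≤ I₂ x} := by
    intro x hx
    by_contra hcon
    simp only [mem_ofPred_eq, not_le] at hcon hx
    have h1 := hx.trans_le ((hI x).trans (add_le_add (hI₁ x) hcon.le))
    rw [← ENNReal.coe_add, add_halves] at h1
    exact lt_irrefl _ h1
  have hA2 : ((A / 2 : ℝ≥0) : ℝ≥0∞) ≠ 0 := by
    rw [ENNReal.coe_ne_zero]; positivity
  have hint : ∫⁻ x, I₂ x ∂μ ≤ K / ε * 2 ^ q * B ^ n * ∫⁻ x, u x ^ q ∂μ := by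
    calc ∫⁻ x, I₂ x ∂μ = ∑' k, 2⁻¹ ^ k * (μ.prod μ) (W k) := by
          rw [lintegral_tsum fun k =>
            ((measurable_measure_prodMk_left (hW k)).const_mul _).aemeasurable]
          refine tsum_congr fun k => ?_
          rw [lintegral_const_mul _ (measurable_measure_prodMk_left (hW k)),
            Measure.prod_apply (hW k)]
      _ ≤ ∑' k, 2⁻¹ ^ k * (K * B ^ n / (ε * d ^ k : ℝ≥0) * μ (V k)) := by
          refine ENNReal.tsum_le_tsum fun k => ?_
          gcongr
          -- Integrating in `x` first exposes the sections at `y`, which are small off `S k`.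
          rw [Measure.prod_apply_symm (hW k), ← setLIntegral_const, ← lintegral_indicator (hV k)]
          refine lintegral_mono fun y => ?_
          by_cases hy : y ∈ V k
          · rw [indicator_of_mem hy]
            refine le_trans (measure_mono ?_) (hS2 k y)
            rintro x ⟨⟨h1, h2⟩, -⟩
            exact ⟨h1, h2⟩
          · rw [indicator_of_notMem hy]
            refine le_of_eq ?_
            rw [show (fun x => (x, y)) ⁻¹' W k = ∅ from
              eq_empty_of_forall_notMem fun x hx => hy hx.2, measure_empty]
      _ = K / ε * B ^ n * ∑' k, (2⁻¹ ^ q) ^ k * μ (V k) := by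
          rw [← ENNReal.tsum_mul_left]
          refine tsum_congr fun k => ?_
          rw [← hdq]
          push_cast
          rw [div_eq_mul_inv, div_eq_mul_inv, ENNReal.mul_inv (by simp) (by simp),
            ENNReal.inv_pow, mul_pow]
          ring
      _ = K / ε * B ^ n * ∫⁻ x, ∑' k, (2⁻¹ ^ q) ^ k * (V k).indicator 1 x ∂μ := by
          rw [lintegral_tsum fun k => ((measurable_one.indicator (hV k)).const_mul _).aemeasurable]
          congr 1
          refine tsum_congr fun k => ?_
          rw [lintegral_const_mul _ (measurable_one.indicator (hV k)), lintegral_indicator_one (hV k)]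
      _ ≤ K / ε * B ^ n * ∫⁻ x, 2 ^ q * u x ^ q ∂μ := by
          gcongr with x
          rw [← ENNReal.mul_rpow_of_nonneg _ _ (by linarith)]
          exact tsum_dyadicShell_le (by linarith) (u x)
      _ = _ := by
          rw [lintegral_const_mul _ (hu.pow_const q)]; ring
  calc _ ≤ μ {x | ((A / 2 : ℝ≥0) : ℝ≥0∞) ≤ I₂ x} := measure_mono hsub
    _ ≤ (∫⁻ x, I₂ x ∂μ) / (A / 2 : ℝ≥0) :=
        meas_ge_le_lintegral_div hI₂m.aemeasurable hA2 ENNReal.coe_ne_top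
    _ ≤ (K / ε * 2 ^ q * B ^ n * ∫⁻ x, u x ^ q ∂μ) / (A / 2 : ℝ≥0) := by gcongr
    _ = _ := by
        have hcoe : ((K / ε * 2 ^ q / (A / 2) : ℝ≥0) : ℝ≥0∞) =
            K / ε * 2 ^ q / ((A / 2 : ℝ≥0) : ℝ≥0∞) := by
          rw [ENNReal.coe_div (by positivity), ENNReal.coe_mul, ENNReal.coe_div hε0.ne',
            ENNReal.coe_rpow_of_ne_zero (by norm_num), ENNReal.coe_ofNat]
        rw [hcoe]
        simp only [div_eq_mul_inv]
        ring

end Core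

/-! ### Summation over scales. -/

section GeometricSums

theorem exists_forall_le_pow_iff {a : ℝ≥0} (ha : 1 < a) {v : ℝ≥0∞} (hv : v ≠ ∞) :
    ∃ N : ℕ, ∀ n, v ≤ (a : ℝ≥0∞) ^ n ↔ N ≤ n := by
  classical
  lift v to ℝ≥0 using hv
  have hex : ∃ n : ℕ, (v : ℝ≥0∞) ≤ (a : ℝ≥0∞) ^ n := by
    obtain ⟨n, hn⟩ := pow_unbounded_of_one_lt v ha
    exact ⟨n, by exact_mod_cast hn.le⟩
  refine ⟨Nat.find hex, fun n => ⟨fun h => Nat.find_min' hex h, fun h => ?_⟩⟩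
  exact (Nat.find_spec hex).trans (pow_le_pow_right₀ (by exact_mod_cast ha.le) h)

theorem exists_tsum_pow_indicator_lt_le {a : ℝ≥0} (ha : 1 < a) {τ : ℝ} (hτ : 0 < τ) :
    ∃ K : ℝ≥0, ∀ v : ℝ≥0∞,
      ∑' n : ℕ, ((a : ℝ≥0∞) ^ τ) ^ n * {w | (a : ℝ≥0∞) ^ n < w}.indicator 1 v ≤ K * v ^ τ := by
  set B : ℝ≥0 := a ^ τ with hB
  have hB1 : 1 < B := NNReal.one_lt_rpow ha hτ
  have hBc : (a : ℝ≥0∞) ^ τ = B := by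
    rw [hB, ENNReal.coe_rpow_of_nonneg _ hτ.le]
  have hB0 : 0 < B - 1 := tsub_pos_of_lt hB1
  -- The identity `c + B = c B` is what closes the induction bounding partial geometric sums by
  -- their last term.
  obtain ⟨c, hc0, hc⟩ : ∃ c : ℝ≥0, 1 ≤ c ∧ c + B = c * B := by
    refine ⟨B / (B - 1), ?_, ?_⟩
    · rw [one_le_div hB0]; exact tsub_le_self
    · have hBe : (B - 1) + 1 = B := tsub_add_cancel_of_le hB1.le
      calc B / (B - 1) + B = B / (B - 1) * ((B - 1) + 1) := by field_simp; ring
        _ = _ := by rw [hBe]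
  have hsum : ∀ M : ℕ, ∑ n ∈ Finset.range (M + 1), B ^ n ≤ c * B ^ M := by
    intro M
    induction M with
    | zero => simpa using hc0
    | succ M ih =>
      rw [Finset.sum_range_succ]
      calc _ ≤ c * B ^ M + B ^ (M + 1) := by gcongr
        _ = (c + B) * B ^ M := by ring
        _ = _ := by rw [hc]; ring
  refine ⟨c, fun v => ?_⟩
  rcases eq_or_ne v ∞ with rfl | hv
  · rw [ENNReal.top_rpow_of_pos hτ, ENNReal.mul_top]
    · exact le_top
    · exact ENNReal.coe_ne_zero.2 (by positivity)
  obtain ⟨N, hN⟩ := exists_forall_le_pow_iff ha hv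
  rw [tsum_eq_sum (s := Finset.range N)]
  · rcases N with _ | M
    · simp
    · calc _ ≤ ∑ n ∈ Finset.range (M + 1), (B : ℝ≥0∞) ^ n := by
            refine Finset.sum_le_sum fun n _ => ?_
            rw [hBc]
            refine mul_le_of_le_one_right' ?_
            exact indicator_le_self' (fun _ _ => zero_le_one) v
        _ ≤ c * (B : ℝ≥0∞) ^ M := by exact_mod_cast hsum M
        _ = c * ((a : ℝ≥0∞) ^ M) ^ τ := by
            rw [← hBc, ← ENNReal.rpow_natCast, ← ENNReal.rpow_natCast, ← ENNReal.rpow_mul,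
              ← ENNReal.rpow_mul, mul_comm τ]
        _ ≤ c * v ^ τ := by
            gcongr
            have := (hN M).not.2 (by simp)
            exact (not_le.1 this).le
  · intro n hn
    rw [indicator_of_notMem, mul_zero]
    exact not_lt.2 ((hN n).2 (by simpa using hn))

/-- From the first `N` with `v ≤ a ^ N` on, the terms decay with ratio `a ^ (τ - q) < 1`. At `N`
itself `v / a ^ N ≤ 1`, so the exponent `q` may be lowered to `τ`. -/
theorem exists_tsum_pow_mul_div_rpow_le {a : ℝ≥0} (ha : 1 < a) {τ q : ℝ} (hτ : 0 < τ)
    (hq : τ < q) :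
    ∃ K : ℝ≥0, ∀ v : ℝ≥0∞, ∑' n : ℕ, ((a : ℝ≥0∞) ^ τ) ^ n *
      {w | w ≤ (a : ℝ≥0∞) ^ n}.indicator (fun w => (w / (a : ℝ≥0∞) ^ n) ^ q) v ≤ K * v ^ τ := by
  set ρ : ℝ≥0 := a ^ (τ - q) with hρ
  have hρ1 : ρ < 1 := NNReal.rpow_lt_one_of_one_lt_of_neg ha (by linarith)
  have ha0 : a ≠ 0 := by positivity
  have ha0' : (a : ℝ≥0∞) ≠ 0 := ENNReal.coe_ne_zero.2 ha0
  have hρ0 : 0 < 1 - ρ := tsub_pos_of_lt hρ1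
  have hρc : (ρ : ℝ≥0∞) = (a : ℝ≥0∞) ^ τ * ((a : ℝ≥0∞) ^ q)⁻¹ := by
    rw [hρ, ENNReal.coe_rpow_of_ne_zero ha0, ← ENNReal.rpow_neg,
      ← ENNReal.rpow_add _ _ ha0' ENNReal.coe_ne_top, sub_eq_add_neg]
  refine ⟨(1 - ρ)⁻¹, fun v => ?_⟩
  rcases eq_or_ne v ∞ with rfl | hv
  · rw [ENNReal.top_rpow_of_pos hτ, ENNReal.mul_top]
    · exact le_top
    · exact ENNReal.coe_ne_zero.2 (by positivity)
  obtain ⟨N, hN⟩ := exists_forall_le_pow_iff ha hv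
  rw [← ENNReal.summable.sum_add_tsum_nat_add' (k := N), Finset.sum_eq_zero, zero_add]
  · have hN0 : (a : ℝ≥0∞) ^ N ≠ 0 := pow_ne_zero _ ha0'
    have hNt : (a : ℝ≥0∞) ^ N ≠ ∞ := ENNReal.pow_ne_top ENNReal.coe_ne_top
    calc _ ≤ ∑' j : ℕ, (((a : ℝ≥0∞) ^ N) ^ τ * (v / (a : ℝ≥0∞) ^ N) ^ q) * (ρ : ℝ≥0∞) ^ j := by
          refine ENNReal.tsum_le_tsum fun j => ?_
          rw [indicator_of_mem (show v ∈ {w | w ≤ (a : ℝ≥0∞) ^ (j + N)} from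
            (hN _).2 (by omega)), hρc, mul_pow, pow_add, pow_add, div_eq_mul_inv,
            div_eq_mul_inv, ENNReal.mul_inv (by simp [ha0']) (by simp),
            ← mul_assoc, ENNReal.mul_rpow_of_nonneg _ _ (by linarith),
            ENNReal.mul_rpow_of_nonneg _ _ (by linarith),
            ENNReal.mul_rpow_of_nonneg _ _ (by linarith)]
          have e1 : (((a : ℝ≥0∞) ^ τ) ^ N) = ((a : ℝ≥0∞) ^ N) ^ τ := by
            rw [← ENNReal.rpow_natCast, ← ENNReal.rpow_natCast, ← ENNReal.rpow_mul,
              ← ENNReal.rpow_mul, mul_comm τ]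
          have e2 : (((a : ℝ≥0∞) ^ j)⁻¹) ^ q = (((a : ℝ≥0∞) ^ q)⁻¹) ^ j := by
            rw [ENNReal.inv_rpow, ← ENNReal.inv_pow, ← ENNReal.rpow_natCast, ← ENNReal.rpow_natCast,
              ← ENNReal.rpow_mul, ← ENNReal.rpow_mul, mul_comm q]
          rw [e1, e2]
          refine le_of_eq ?_
          ring
      _ = ((a : ℝ≥0∞) ^ N) ^ τ * (v / (a : ℝ≥0∞) ^ N) ^ q * ((1 - ρ : ℝ≥0) : ℝ≥0∞)⁻¹ := by
          rw [ENNReal.tsum_mul_left, ENNReal.tsum_geometric, ENNReal.coe_sub, ENNReal.coe_one]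
      _ ≤ ((a : ℝ≥0∞) ^ N) ^ τ * (v / (a : ℝ≥0∞) ^ N) ^ τ * ((1 - ρ : ℝ≥0) : ℝ≥0∞)⁻¹ := by
          gcongr 2
          refine ENNReal.rpow_le_rpow_of_exponent_ge ?_ hq.le
          exact ENNReal.div_le_of_le_mul (by simpa using (hN N).2 le_rfl)
      _ = _ := by
          rw [← ENNReal.mul_rpow_of_nonneg _ _ hτ.le, ENNReal.mul_div_cancel hN0 hNt,
            ENNReal.coe_inv hρ0.ne', mul_comm]
  · intro n hn
    rw [indicator_of_notMem, mul_zero]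
    exact fun h => absurd ((hN n).1 h) (by simpa using hn)

end GeometricSums

theorem ENNReal.inv_le_mul_inv_of_le_mul {m m' L : ℝ≥0∞} (h0 : L ≠ 0) (ht : L ≠ ∞)
    (h : m' ≤ L * m) : m⁻¹ ≤ L * m'⁻¹ := by
  calc m⁻¹ = L * (L * m)⁻¹ := by
        rw [ENNReal.mul_inv (Or.inl h0) (Or.inl ht), ← mul_assoc, ENNReal.mul_inv_cancel h0 ht,
          one_mul]
    _ ≤ _ := by gcongr

/-! ### Smoothing at unit scale. -/

section Averages

variable {X : Type*} [MetricSpace X] [MeasurableSpace X]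

/-- After Fubini, each `z` in `B(x, r)` carries the weight `∫_{B(z, 1)} μ(B(y, 1))⁻¹`, which is at
least `L⁻¹` because `B(y, 1) ⊆ B(z, 2)`. -/
theorem lintegral_ball_le_lintegral_ballAverage [BorelSpace X]
    [SecondCountableTopology X] {μ : Measure X} (h : IsLocallyDoubling μ)
    {L : ℝ≥0} (hL0 : 0 < L)
    (hL : ∀ (x : X) (r : ℝ), 0 < r → r ≤ 4 → μ (Metric.ball x (2 * r)) ≤ L * μ (Metric.ball x r))
    {F : X → ℝ≥0∞} (hF : Measurable F) (x : X) (r : ℝ) :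
    ∫⁻ y in Metric.ball x r, F y ∂μ ≤
      L * ∫⁻ y in Metric.ball x (r + 1), ballAverage μ 1 F y ∂μ := by
  have := h.sigmaFinite
  set w : X → ℝ≥0∞ := (Metric.ball x (r + 1)).indicator fun y => (μ (Metric.ball y 1))⁻¹ with hw
  have hwm : Measurable w :=
    (measurable_measure_ball μ 1).inv.indicator Metric.isOpen_ball.measurableSet
  have hLne : (L : ℝ≥0∞) ≠ 0 := ENNReal.coe_ne_zero.2 hL0.ne'
  have e : ∫⁻ y in Metric.ball x (r + 1), ballAverage μ 1 F y ∂μ =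
      ∫⁻ z, F z * ∫⁻ y in Metric.ball z 1, w y ∂μ ∂μ := by
    rw [← lintegral_mul_lintegral_ball μ hwm hF,
      ← lintegral_indicator Metric.isOpen_ball.measurableSet]
    refine lintegral_congr fun y => ?_
    by_cases hy : y ∈ Metric.ball x (r + 1)
    · simp only [hw, indicator_of_mem hy]; rfl
    · simp [hw, indicator_of_notMem hy]
  have hz : ∀ z ∈ Metric.ball x r, (L : ℝ≥0∞)⁻¹ ≤ ∫⁻ y in Metric.ball z 1, w y ∂μ := by
    intro z hz
    have hpos := h.ball_pos z 1 one_pos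
    have hfin := h.ball_lt_top z 1 one_pos
    calc (L : ℝ≥0∞)⁻¹ = (L * μ (Metric.ball z 1))⁻¹ * μ (Metric.ball z 1) := by
          rw [ENNReal.mul_inv (Or.inl hLne) (Or.inl ENNReal.coe_ne_top), mul_assoc,
            ENNReal.inv_mul_cancel hpos.ne' hfin.ne, mul_one]
      _ = ∫⁻ _ in Metric.ball z 1, (L * μ (Metric.ball z 1))⁻¹ ∂μ := (setLIntegral_const _ _).symm
      _ ≤ _ := by
          refine setLIntegral_mono hwm fun y hy => ?_
          rw [Metric.mem_ball] at hy hz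
          have := dist_triangle y z x
          rw [hw, indicator_of_mem (Metric.mem_ball.2 (by linarith)), ENNReal.inv_le_inv]
          refine le_trans (measure_mono (Metric.ball_subset_ball' ?_)) (hL z 1 one_pos (by norm_num))
          linarith
  rw [e]
  calc ∫⁻ y in Metric.ball x r, F y ∂μ = L * ∫⁻ y in Metric.ball x r, F y * (L : ℝ≥0∞)⁻¹ ∂μ := by
        rw [lintegral_mul_const _ hF, mul_comm (∫⁻ y in Metric.ball x r, F y ∂μ), ← mul_assoc,
          ENNReal.mul_inv_cancel hLne ENNReal.coe_ne_top, one_mul]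
    _ ≤ L * ∫⁻ y in Metric.ball x r, F y * ∫⁻ y in Metric.ball y 1, w y ∂μ ∂μ := by
        gcongr 1
        refine setLIntegral_mono (hF.mul (measurable_lintegral_ball μ w 1)) fun z hz' => ?_
        gcongr
        exact hz z hz'
    _ ≤ _ := by gcongr; exact Measure.restrict_le_self

/-- A Harnack-type comparison: a large unit average persists, at radius two, on a whole unit ball.
-/
theorem ballAverage_one_le {μ : Measure X} {L : ℝ≥0} (hL0 : 0 < L)
    (hL : ∀ (x : X) (r : ℝ), 0 < r → r ≤ 4 → μ (Metric.ball x (2 * r)) ≤ L * μ (Metric.ball x r))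
    (F : X → ℝ≥0∞) {y z : X} (hyz : dist z y < 1) :
    ballAverage μ 1 F y ≤ L ^ 2 * ballAverage μ 2 F z := by
  have hLne : (L : ℝ≥0∞) ≠ 0 := ENNReal.coe_ne_zero.2 hL0.ne'
  have h1 : μ (Metric.ball z 2) ≤ L ^ 2 * μ (Metric.ball y 1) := by
    calc μ (Metric.ball z 2) ≤ L * μ (Metric.ball z 1) := by
          simpa using hL z 1 one_pos (by norm_num)
      _ ≤ L * μ (Metric.ball y 2) := by
          gcongr; exact Metric.ball_subset_ball' (by linarith)
      _ ≤ L * (L * μ (Metric.ball y 1)) := by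
          gcongr; simpa using hL y 1 one_pos (by norm_num)
      _ = _ := by ring
  have hL2 : (L : ℝ≥0∞) ^ 2 ≠ 0 := pow_ne_zero _ hLne
  have h2 : (μ (Metric.ball y 1))⁻¹ ≤ L ^ 2 * (μ (Metric.ball z 2))⁻¹ :=
    ENNReal.inv_le_mul_inv_of_le_mul hL2 (by simp) h1
  unfold ballAverage
  rw [← mul_assoc]
  gcongr
  refine Metric.ball_subset_ball' ?_
  rw [dist_comm]; linarith

theorem lintegral_ballAverage_rpow_le [BorelSpace X] [SecondCountableTopology X] {μ : Measure X}
    (h : IsLocallyDoubling μ) {L : ℝ≥0} (hL0 : 0 < L)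
    (hL : ∀ (x : X) (r : ℝ), 0 < r → r ≤ 4 → μ (Metric.ball x (2 * r)) ≤ L * μ (Metric.ball x r))
    {F : X → ℝ≥0∞} (hF : Measurable F) {p : ℝ} (hp : 1 ≤ p) :
    ∫⁻ y, ballAverage μ 2 F y ^ p ∂μ ≤ L * ∫⁻ y, F y ^ p ∂μ := by
  have := h.sigmaFinite
  calc ∫⁻ y, ballAverage μ 2 F y ^ p ∂μ
      ≤ ∫⁻ y, (μ (Metric.ball y 2))⁻¹ * ∫⁻ z in Metric.ball y 2, F z ^ p ∂μ ∂μ :=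
        lintegral_mono fun y => ballAverage_rpow_le h hp two_pos hF y
    _ = ∫⁻ z, F z ^ p * ∫⁻ y in Metric.ball z 2, (μ (Metric.ball y 2))⁻¹ ∂μ ∂μ :=
        lintegral_mul_lintegral_ball μ (measurable_measure_ball μ 2).inv (hF.pow_const p) 2
    _ ≤ ∫⁻ z, F z ^ p * L ∂μ := by
        gcongr with z
        have hpos := h.ball_pos z 2 two_pos
        have hfin := h.ball_lt_top z 2 two_pos
        calc ∫⁻ y in Metric.ball z 2, (μ (Metric.ball y 2))⁻¹ ∂μ
            ≤ ∫⁻ _ in Metric.ball z 2, L * (μ (Metric.ball z 2))⁻¹ ∂μ := by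
              refine setLIntegral_mono measurable_const fun y hy => ?_
              refine ENNReal.inv_le_mul_inv_of_le_mul (ENNReal.coe_ne_zero.2 hL0.ne')
                ENNReal.coe_ne_top ?_
              refine le_trans (measure_mono ?_) (hL y 2 two_pos (by norm_num))
              rw [Metric.mem_ball, dist_comm] at hy
              exact Metric.ball_subset_ball' (by linarith)
          _ = L := by
              rw [setLIntegral_const, mul_assoc, ENNReal.inv_mul_cancel hpos.ne' hfin.ne, mul_one]
    _ = _ := by rw [lintegral_mul_const _ (hF.pow_const p), mul_comm]

/-- The set of points at bounded distance from a superlevel set of `g` is controlled by the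
superlevel set of a function dominating `g` on balls of radius one. -/
theorem exists_measure_thickening_le [BorelSpace X]
    [SecondCountableTopology X] {μ : Measure X} (h : IsLocallyDoubling μ) {a b : ℝ}
    (ha : 0 < a) (hb : 0 < b) (hexp : HasPinchedExpGrowth μ a b) :
    ∃ K : ℝ≥0, ∀ (n : ℕ) (T : ℝ≥0∞) (g g' : X → ℝ≥0∞), Measurable g' →
      (∀ y z, dist z y < 1 → g y ≤ g' z) →
      μ {x | ∃ y ∈ Metric.ball x (n + 1), T < g y} ≤
        K * ENNReal.ofReal b ^ n * μ {x | T < g' x} := by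
  have := h.sigmaFinite
  obtain ⟨c, C, hc, hC, hvol⟩ := hexp
  have hm : 0 < c * a := by positivity
  refine ⟨(C * b ^ 2 / (c * a)).toNNReal, fun n T g g' hg' hgg' => ?_⟩
  set G : Set X := {x | T < g' x}
  have hG : MeasurableSet G := measurableSet_lt measurable_const hg'
  -- A point where `g > T` brings the unit ball around it into `G`, so `G` has mass at least `c a`
  -- within `B(x, n + 2)`. Chebyshev and Fubini then finish. This is why `F` is smoothed: its own
  -- superlevel sets may be arbitrarily small.
  have hsub : {x | ∃ y ∈ Metric.ball x (n + 1), T < g y} ⊆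
      {x | ENNReal.ofReal (c * a) ≤ ∫⁻ y in Metric.ball x (n + 2), G.indicator 1 y ∂μ} := by
    rintro x ⟨y, hy, hT⟩
    rw [mem_ofPred_eq, lintegral_indicator_one hG, Measure.restrict_apply hG]
    have := (hvol y 1 le_rfl).1
    rw [Real.rpow_one] at this
    refine this.trans (measure_mono fun z hz => ?_)
    rw [Metric.mem_ball] at hz hy
    refine ⟨hT.trans_le (hgg' y z hz), ?_⟩
    have := dist_triangle z y x
    rw [Metric.mem_ball]; linarith
  have hint : ∫⁻ x, ∫⁻ y in Metric.ball x (n + 2), G.indicator 1 y ∂μ ∂μ ≤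
      ENNReal.ofReal (C * b ^ 2) * ENNReal.ofReal b ^ n * μ G := by
    have := lintegral_mul_lintegral_ball μ (w := 1) (F := G.indicator 1) measurable_one
      (measurable_one.indicator hG) (n + 2)
    simp only [Pi.one_apply, one_mul, lintegral_one, Measure.restrict_apply_univ] at this
    rw [this, ← lintegral_indicator_one hG, ← lintegral_const_mul _ (measurable_one.indicator hG)]
    refine lintegral_mono fun z => ?_
    rw [mul_comm]
    gcongr
    refine (hvol z _ (by linarith [n.cast_nonneg (α := ℝ)])).2.trans (le_of_eq ?_)
    rw [← ENNReal.ofReal_pow hb.le, ← ENNReal.ofReal_mul (by positivity), Real.rpow_add hb,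
      Real.rpow_natCast, Real.rpow_ofNat]
    ring_nf
  calc _ ≤ _ := measure_mono hsub
    _ ≤ (∫⁻ x, ∫⁻ y in Metric.ball x (n + 2), G.indicator 1 y ∂μ ∂μ) / ENNReal.ofReal (c * a) :=
        meas_ge_le_lintegral_div (measurable_lintegral_ball μ _ _).aemeasurable
          (by simpa using hm) ENNReal.ofReal_ne_top
    _ ≤ (ENNReal.ofReal (C * b ^ 2) * ENNReal.ofReal b ^ n * μ G) / ENNReal.ofReal (c * a) := by
        gcongr
    _ = _ := by
        change _ = ENNReal.ofReal (C * b ^ 2 / (c * a)) * _ * _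
        rw [ENNReal.ofReal_div_of_pos hm]
        simp only [div_eq_mul_inv]
        ring

end Averages

/-! ### Weak type at the endpoint for radii at least one. -/

section Global

variable {X : Type*} [MetricSpace X] [MeasurableSpace X] [BorelSpace X]
  [SecondCountableTopology X]

theorem weakType_global {μ : Measure X} {a b δ : ℝ} (ha : 1 < a) (hab : a ≤ b) (hb : b < a ^ 2)
    (hδ : 0 ≤ δ) (hlen : IsStrictlyIntrinsic X) (hhyp : IsGromovHyperbolic X δ)
    (h : IsLocallyDoubling μ) (hexp : HasPinchedExpGrowth μ a b) (o : X) :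
    ∃ K : ℝ≥0, ∀ (F : X → ℝ≥0∞), Measurable F → ∀ t : ℝ≥0∞, t ≠ 0 → t ≠ ∞ →
      μ {x | ∃ r, 1 ≤ r ∧ t < ballAverage μ r F x} ≤
        K * (∫⁻ x, F x ^ Real.logb a b ∂μ) / t ^ Real.logb a b := by
  have := h.sigmaFinite
  have ha0 : 0 < a := by linarith
  have hb1 : 1 < b := by linarith
  have hb0 : 0 < b := by linarith
  set τ := Real.logb a b with hτ
  have haτ : a ^ τ = b := Real.rpow_logb ha0 ha.ne' hb0
  have hτ1 : 1 ≤ τ := by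
    rw [hτ, Real.le_logb_iff_rpow_le ha hb0]; simpa using hab
  have hτ2 : τ < 2 := by
    rw [hτ, Real.logb_lt_iff_lt_rpow ha hb0]; exact_mod_cast hb
  have hτ0 : 0 < τ := by linarith
  obtain ⟨q, hq1, hq2⟩ := exists_between hτ2
  set α : ℝ≥0 := a.toNNReal with hα
  have hα1 : 1 < α := Real.one_lt_toNNReal.2 ha
  have hα0 : (α : ℝ≥0∞) ≠ 0 := ENNReal.coe_ne_zero.2 (by positivity)
  have hB : ENNReal.ofReal b = (α : ℝ≥0∞) ^ τ := by
    change _ = ENNReal.ofReal a ^ τ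
    rw [ENNReal.ofReal_rpow_of_pos ha0, haτ]
  obtain ⟨L, hL0, hL⟩ := h.exists_pos (s := 4) (by norm_num)
  have hLne : (L : ℝ≥0∞) ≠ 0 := ENNReal.coe_ne_zero.2 hL0.ne'
  obtain ⟨K₂, hK₂⟩ := exists_measure_thickening_le h ha0 hb0 hexp
  obtain ⟨c, C, hc, hC, hvol⟩ := hexp
  obtain ⟨K₀, hK₀, hsplit⟩ := exists_kernel_splitting (μ := μ) hδ hhyp hlen hb1 hC
    (fun x r hr => (hvol x r hr).2) o
  -- With `n = ⌈r⌉` one has `r ≥ n - 1`, so `c a ^ r ≥ (c / a) a ^ n`.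
  set c' : ℝ≥0 := (c / a).toNNReal with hc'
  have hc'0 : 0 < c' := Real.toNNReal_pos.2 (by positivity)
  obtain ⟨K₁, hK₁⟩ := exists_measure_lintegral_ball_le hK₀ hsplit (hτ1.trans_lt hq1) hq2
    (A := c' / L) (by positivity)
  obtain ⟨K₃, hK₃⟩ := exists_tsum_pow_indicator_lt_le hα1 hτ0
  obtain ⟨K₄, hK₄⟩ := exists_tsum_pow_mul_div_rpow_le hα1 hτ0 hq1
  rw [hB] at hK₁ hK₂
  refine ⟨(K₁ * α ^ τ * K₄ + K₂ * K₃) * (L ^ 2) ^ τ * L, fun F hF t ht0 ht => ?_⟩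
  set g := ballAverage μ 1 F with hg
  have hgm : Measurable g := measurable_ballAverage μ F 1
  set g' : X → ℝ≥0∞ := fun x => L ^ 2 * ballAverage μ 2 F x with hg'
  have hgm' : Measurable g' := (measurable_ballAverage μ F 2).const_mul _
  have hgg' : ∀ y z, dist z y < 1 → g y ≤ g' z := fun y z hyz =>
    ballAverage_one_le hL0 hL F hyz
  have hpow0 : ∀ n : ℕ, (α : ℝ≥0∞) ^ n ≠ 0 := fun n => pow_ne_zero _ hα0
  have hpowt : ∀ n : ℕ, (α : ℝ≥0∞) ^ n ≠ ∞ := fun n => ENNReal.pow_ne_top ENNReal.coe_ne_top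
  -- The cut-off ensures `u n ≤ 1`; outside `Q n` it changes nothing on the ball in question.
  set u : ℕ → X → ℝ≥0∞ := fun n x =>
    {w : ℝ≥0∞ | w ≤ (α : ℝ≥0∞) ^ n}.indicator (fun w => w / (α : ℝ≥0∞) ^ n) (g x / t) with hu
  have hum : ∀ n, Measurable (u n) := fun n =>
    ((measurable_id.div_const _).indicator measurableSet_Iic).comp (hgm.div_const t)
  have hu1 : ∀ n x, u n x ≤ 1 := by
    intro n x
    by_cases hx : g x / t ∈ {w : ℝ≥0∞ | w ≤ (α : ℝ≥0∞) ^ n}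
    · simp only [hu, indicator_of_mem hx]
      exact ENNReal.div_le_of_le_mul (by simpa using hx)
    · simp [hu, indicator_of_notMem hx]
  set P : ℕ → Set X := fun n => {x | ((c' / L : ℝ≥0) : ℝ≥0∞) <
    ∫⁻ y in Metric.ball x (n + 1 : ℕ), u n y ∂μ} with hP
  set Q : ℕ → Set X := fun n => {x | ∃ y ∈ Metric.ball x (n + 1), t * (α : ℝ≥0∞) ^ n < g y}
  have hsub : {x | ∃ r, 1 ≤ r ∧ t < ballAverage μ r F x} ⊆ ⋃ n, (P n ∪ Q n) := by
    rintro x ⟨r, hr, hx⟩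
    refine mem_iUnion.2 ⟨⌈r⌉₊, ?_⟩
    set n := ⌈r⌉₊
    have hr0 : 0 < r := by linarith
    have hrn : r ≤ n := Nat.le_ceil r
    have hnr : (n : ℝ) < r + 1 := Nat.ceil_lt_add_one hr0.le
    by_cases hQ : x ∈ Q n
    · exact Or.inr hQ
    left
    have hle : ∀ y ∈ Metric.ball x (n + 1), g y ≤ t * (α : ℝ≥0∞) ^ n := fun y hy =>
      not_lt.1 fun hlt => hQ ⟨y, hy, hlt⟩
    have hgu : ∀ y ∈ Metric.ball x (n + 1), g y = (t * (α : ℝ≥0∞) ^ n) * u n y := by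
      intro y hy
      have hmem : g y / t ∈ {w : ℝ≥0∞ | w ≤ (α : ℝ≥0∞) ^ n} :=
        ENNReal.div_le_of_le_mul' (hle y hy)
      simp only [hu, indicator_of_mem hmem]
      rw [mul_assoc, ENNReal.mul_div_cancel (hpow0 n) (hpowt n), ENNReal.mul_div_cancel ht0 ht]
    have hpos := h.ball_pos x r hr0
    have hfin := h.ball_lt_top x r hr0
    have h1 : t * (c' * (α : ℝ≥0∞) ^ n) < ∫⁻ y in Metric.ball x n, F y ∂μ := by
      calc t * (c' * (α : ℝ≥0∞) ^ n) ≤ t * μ (Metric.ball x r) := by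
            gcongr
            refine le_trans ?_ (hvol x r hr).1
            change ENNReal.ofReal (c / a) * ENNReal.ofReal a ^ n ≤ _
            rw [← ENNReal.ofReal_pow ha0.le, ← ENNReal.ofReal_mul (by positivity)]
            refine ENNReal.ofReal_le_ofReal ?_
            calc c / a * a ^ n = c * a ^ ((n : ℝ) - 1) := by
                  rw [Real.rpow_sub_one ha0.ne', Real.rpow_natCast]; ring
              _ ≤ c * a ^ r := by
                  gcongr
                  · exact ha.le
                  · linarith
        _ < ballAverage μ r F x * μ (Metric.ball x r) :=
            ENNReal.mul_lt_mul_left hpos.ne' hfin.ne hx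
        _ = ∫⁻ y in Metric.ball x r, F y ∂μ := by
            unfold ballAverage
            rw [mul_comm, ← mul_assoc, ENNReal.mul_inv_cancel hpos.ne' hfin.ne, one_mul]
        _ ≤ _ := lintegral_mono_set (Metric.ball_subset_ball hrn)
    have h2 := h1.trans_le (lintegral_ball_le_lintegral_ballAverage h hL0 hL hF x n)
    rw [setLIntegral_congr_fun Metric.isOpen_ball.measurableSet hgu,
      lintegral_const_mul _ (hum n)] at h2
    simp only [hP, mem_ofPred_eq]
    push_cast
    by_contra hcon
    rw [not_lt, ENNReal.coe_div hL0.ne'] at hcon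
    refine absurd h2 (not_lt.2 ?_)
    calc _ ≤ (L : ℝ≥0∞) * (t * (α : ℝ≥0∞) ^ n * (c' / L)) := by gcongr
      _ = t * (α : ℝ≥0∞) ^ n * (L * (c' / L)) := by ring
      _ = _ := by rw [ENNReal.mul_div_cancel hLne ENNReal.coe_ne_top]; ring
  have hPn : ∀ n, μ (P n) ≤ K₁ * α ^ τ * ∫⁻ x, ((α : ℝ≥0∞) ^ τ) ^ n *
      {w | w ≤ (α : ℝ≥0∞) ^ n}.indicator (fun w => (w / (α : ℝ≥0∞) ^ n) ^ q) (g x / t) ∂μ := by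
    intro n
    -- The radius is `n + 1`, whence one extra factor `α ^ τ`.
    refine (hK₁ (n + 1) (u n) (hum n) (hu1 n)).trans (le_of_eq ?_)
    have : ∀ x, u n x ^ q = {w | w ≤ (α : ℝ≥0∞) ^ n}.indicator
        (fun w => (w / (α : ℝ≥0∞) ^ n) ^ q) (g x / t) := by
      intro x
      by_cases hx : g x / t ∈ {w : ℝ≥0∞ | w ≤ (α : ℝ≥0∞) ^ n}
      · simp only [hu, indicator_of_mem hx]
      · simp only [hu, indicator_of_notMem hx]
        exact ENNReal.zero_rpow_of_pos (by linarith)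
    simp only [← this]
    rw [lintegral_const_mul _ ((hum n).pow_const q)]
    ring
  have hQn : ∀ n, μ (Q n) ≤ K₂ * ∫⁻ x, ((α : ℝ≥0∞) ^ τ) ^ n *
      {w | (α : ℝ≥0∞) ^ n < w}.indicator 1 (g' x / t) ∂μ := by
    intro n
    refine (hK₂ n _ g g' hgm' hgg').trans (le_of_eq ?_)
    have hS : MeasurableSet {x | t * (α : ℝ≥0∞) ^ n < g' x} :=
      measurableSet_lt measurable_const hgm'
    have : ∀ x, {w | (α : ℝ≥0∞) ^ n < w}.indicator (1 : ℝ≥0∞ → ℝ≥0∞) (g' x / t) =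
        {x | t * (α : ℝ≥0∞) ^ n < g' x}.indicator 1 x := by
      intro x
      simp only [indicator, mem_ofPred_eq, Pi.one_apply]
      simp only [ENNReal.lt_div_iff_mul_lt (Or.inl ht0) (Or.inl ht), mul_comm t]
    simp only [this]
    rw [lintegral_const_mul _ (measurable_one.indicator hS), lintegral_indicator_one hS, mul_assoc]
  have hm₁ : ∀ n : ℕ, Measurable fun x => ((α : ℝ≥0∞) ^ τ) ^ n *
      {w | w ≤ (α : ℝ≥0∞) ^ n}.indicator (fun w => (w / (α : ℝ≥0∞) ^ n) ^ q) (g x / t) := fun n =>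
    Measurable.const_mul ((((measurable_id.div_const _).pow_const q).indicator
      measurableSet_Iic).comp (hgm.div_const t)) _
  have hm₂ : ∀ n : ℕ, Measurable fun x => ((α : ℝ≥0∞) ^ τ) ^ n *
      {w | (α : ℝ≥0∞) ^ n < w}.indicator (1 : ℝ≥0∞ → ℝ≥0∞) (g' x / t) := fun n =>
    Measurable.const_mul ((measurable_one.indicator measurableSet_Ioi).comp (hgm'.div_const t)) _
  have hgle : ∀ x, g x ≤ g' x := fun x => hgg' x x (by simp)
  calc _ ≤ μ (⋃ n, (P n ∪ Q n)) := measure_mono hsub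
    _ ≤ ∑' n, (μ (P n) + μ (Q n)) :=
        (measure_iUnion_le _).trans (ENNReal.tsum_le_tsum fun n => measure_union_le _ _)
    _ = ∑' n, μ (P n) + ∑' n, μ (Q n) := ENNReal.tsum_add
    _ ≤ K₁ * α ^ τ * ∫⁻ x, K₄ * (g x / t) ^ τ ∂μ + K₂ * ∫⁻ x, K₃ * (g' x / t) ^ τ ∂μ := by
        gcongr
        · refine (ENNReal.tsum_le_tsum hPn).trans ?_
          rw [ENNReal.tsum_mul_left, ← lintegral_tsum fun n => (hm₁ n).aemeasurable]
          gcongr with x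
          exact hK₄ _
        · refine (ENNReal.tsum_le_tsum hQn).trans ?_
          rw [ENNReal.tsum_mul_left, ← lintegral_tsum fun n => (hm₂ n).aemeasurable]
          gcongr with x
          exact hK₃ _
    _ ≤ K₁ * α ^ τ * ∫⁻ x, K₄ * (g' x / t) ^ τ ∂μ + K₂ * ∫⁻ x, K₃ * (g' x / t) ^ τ ∂μ := by
        gcongr with x
        exact hgle x
    _ = (K₁ * α ^ τ * K₄ + K₂ * K₃) * ∫⁻ x, (g' x / t) ^ τ ∂μ := by
        rw [lintegral_const_mul _ ((hgm'.div_const t).pow_const τ),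
          lintegral_const_mul _ ((hgm'.div_const t).pow_const τ)]
        ring
    _ = (K₁ * α ^ τ * K₄ + K₂ * K₃) * ((L ^ 2) ^ τ * (t ^ τ)⁻¹ *
          ∫⁻ x, ballAverage μ 2 F x ^ τ ∂μ) := by
        rw [← lintegral_const_mul _ ((measurable_ballAverage μ F 2).pow_const τ)]
        congr 1
        refine lintegral_congr fun x => ?_
        rw [ENNReal.div_rpow_of_nonneg _ _ hτ0.le, hg', ENNReal.mul_rpow_of_nonneg _ _ hτ0.le,
          div_eq_mul_inv]
        ring
    _ ≤ (K₁ * α ^ τ * K₄ + K₂ * K₃) * ((L ^ 2) ^ τ * (t ^ τ)⁻¹ *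
          (L * ∫⁻ x, F x ^ τ ∂μ)) := by
        gcongr
        exact lintegral_ballAverage_rpow_le h hL0 hL hF hτ1
    _ = _ := by
        rw [ENNReal.coe_mul, ENNReal.coe_mul, ENNReal.coe_rpow_of_nonneg _ hτ0.le]
        push_cast
        rw [ENNReal.coe_rpow_of_nonneg _ hτ0.le, div_eq_mul_inv]
        ring

end Global

/-! ### Layer-cake formulas for interpolation. -/

section Interpolation

theorem lintegral_Ioi_indicator_mul_rpow {σ : ℝ} (hσ : 0 < σ) (v : ℝ≥0∞) :
    ∫⁻ t in Ioi (0 : ℝ), {t : ℝ | ENNReal.ofReal t < v}.indicator 1 t *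
      ENNReal.ofReal (t ^ (σ - 1)) = v ^ σ / ENNReal.ofReal σ := by
  have key : ∀ r : ℝ≥0, ∫⁻ t in Ioi (0 : ℝ), {t : ℝ | ENNReal.ofReal t < r}.indicator 1 t *
      ENNReal.ofReal (t ^ (σ - 1)) = (r : ℝ≥0∞) ^ σ / ENNReal.ofReal σ := by
    intro r
    -- The layer-cake formula on a one-point space gives the pointwise identity.
    have h := lintegral_rpow_eq_lintegral_meas_lt_mul (Measure.dirac ()) (f := fun _ => (r : ℝ))
      (Filter.Eventually.of_forall fun _ => r.2) aemeasurable_const hσ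
    rw [lintegral_const, Measure.dirac_apply_of_mem (mem_univ _), mul_one,
      ← ENNReal.ofReal_rpow_of_nonneg r.coe_nonneg hσ.le, ENNReal.ofReal_coe_nnreal] at h
    rw [h, mul_comm, ENNReal.mul_div_cancel_right (by simpa using hσ) ENNReal.ofReal_ne_top]
    refine setLIntegral_congr_fun measurableSet_Ioi fun t ht => ?_
    have ht' : (0 : ℝ) < t := ht
    by_cases hr : t < r
    · have : ENNReal.ofReal t < r := by
        rwa [← ENNReal.ofReal_coe_nnreal, ENNReal.ofReal_lt_ofReal_iff_of_nonneg ht'.le]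
      simp [indicator, this, hr]
    · have : ¬ ENNReal.ofReal t < r := by
        rwa [← ENNReal.ofReal_coe_nnreal, ENNReal.ofReal_lt_ofReal_iff_of_nonneg ht'.le]
      simp [indicator, this, hr]
  induction v with
  | coe r => exact key r
  | top =>
    have h0 : ENNReal.ofReal σ ≠ 0 := by simpa using hσ
    rw [ENNReal.top_rpow_of_pos hσ, ENNReal.top_div_of_ne_top ENNReal.ofReal_ne_top]
    refine ENNReal.eq_top_of_forall_nnreal_le fun r => ?_
    -- At this height the integral equals `r`; since `r` is arbitrary, monotonicity gives the value
    -- `∞` at `v = ∞`.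
    have hr := key ((r * σ.toNNReal) ^ (1 / σ))
    rw [ENNReal.coe_rpow_of_nonneg _ (by positivity), ← ENNReal.rpow_mul,
      one_div_mul_cancel hσ.ne', ENNReal.rpow_one, ENNReal.coe_mul] at hr
    change _ = r * ENNReal.ofReal σ / ENNReal.ofReal σ at hr
    rw [ENNReal.mul_div_cancel_right h0 ENNReal.ofReal_ne_top] at hr
    rw [← hr]
    gcongr with t
    simp

/-- Insert the bound into the layer-cake formula and exchange integrals: integrating `t ^ (p - τ -
1)` over `t < 2F` leaves `(2F) ^ (p - τ) / (p - τ)`. The threshold `2F` reflects truncation of `F`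
at height `t / 2`. -/
theorem lintegral_rpow_le_of_measure_lt_le {X : Type*} [MeasurableSpace X] {μ : Measure X}
    [SFinite μ] {τ p : ℝ} (hτ : 0 < τ) (hp : τ < p) {K : ℝ≥0∞} {F G : X → ℝ≥0∞}
    (hF : Measurable F) (hG : Measurable G)
    (h : ∀ t : ℝ, 0 < t → μ {x | ENNReal.ofReal t < G x} ≤
      K * (∫⁻ x in {x | ENNReal.ofReal t < 2 * F x}, F x ^ τ ∂μ) / ENNReal.ofReal t ^ τ) :
    ∫⁻ x, G x ^ p ∂μ ≤
      ENNReal.ofReal p * K * 2 ^ (p - τ) / ENNReal.ofReal (p - τ) * ∫⁻ x, F x ^ p ∂μ := by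
  have hp0 : 0 < p := hτ.trans hp
  have hpτ : 0 < p - τ := sub_pos.2 hp
  have hpm : ∀ σ : ℝ, Measurable fun t : ℝ => ENNReal.ofReal (t ^ (σ - 1)) := fun σ =>
    (measurable_id.pow_const _).ennreal_ofReal
  have hGS : MeasurableSet {z : X × ℝ | ENNReal.ofReal z.2 < G z.1} :=
    measurableSet_lt measurable_snd.ennreal_ofReal (hG.comp measurable_fst)
  have hFS : MeasurableSet {z : X × ℝ | ENNReal.ofReal z.2 < 2 * F z.1} :=
    measurableSet_lt measurable_snd.ennreal_ofReal ((hF.const_mul 2).comp measurable_fst)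
  have e1 : ∀ x, G x ^ p = ENNReal.ofReal p * ∫⁻ t in Ioi (0 : ℝ),
      {z : X × ℝ | ENNReal.ofReal z.2 < G z.1}.indicator 1 (x, t) *
        ENNReal.ofReal (t ^ (p - 1)) := by
    intro x
    have := lintegral_Ioi_indicator_mul_rpow hp0 (G x)
    refine (ENNReal.mul_div_cancel (a := ENNReal.ofReal p) (by simpa using hp0)
      ENNReal.ofReal_ne_top).symm.trans ?_
    rw [← this]; rfl
  have hGm : Measurable fun z : X × ℝ =>
      {z : X × ℝ | ENNReal.ofReal z.2 < G z.1}.indicator (1 : X × ℝ → ℝ≥0∞) z *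
        ENNReal.ofReal (z.2 ^ (p - 1)) :=
    (measurable_one.indicator hGS).mul ((hpm p).comp measurable_snd)
  have hFm : Measurable fun z : X × ℝ =>
      {z : X × ℝ | ENNReal.ofReal z.2 < 2 * F z.1}.indicator (1 : X × ℝ → ℝ≥0∞) z *
        F z.1 ^ τ * ENNReal.ofReal (z.2 ^ (p - τ - 1)) :=
    ((measurable_one.indicator hFS).mul ((hF.pow_const τ).comp measurable_fst)).mul
      ((hpm (p - τ)).comp measurable_snd)
  calc ∫⁻ x, G x ^ p ∂μ = ENNReal.ofReal p * ∫⁻ x, (∫⁻ t in Ioi (0 : ℝ),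
        {z : X × ℝ | ENNReal.ofReal z.2 < G z.1}.indicator 1 (x, t) *
          ENNReal.ofReal (t ^ (p - 1))) ∂μ := by
        simp only [e1]
        exact lintegral_const_mul _ hGm.lintegral_prod_right'
    _ = ENNReal.ofReal p * ∫⁻ t in Ioi (0 : ℝ), μ {x | ENNReal.ofReal t < G x} *
          ENNReal.ofReal (t ^ (p - 1)) := by
        rw [lintegral_lintegral_swap hGm.aemeasurable]
        congr 1
        refine lintegral_congr fun t => ?_
        have hS : MeasurableSet {x | ENNReal.ofReal t < G x} :=
          measurableSet_lt measurable_const hG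
        rw [← lintegral_indicator_one hS,
          ← lintegral_mul_const _ (measurable_one.indicator hS)]
        rfl
    _ ≤ ENNReal.ofReal p * ∫⁻ t in Ioi (0 : ℝ), K * ∫⁻ x,
          {z : X × ℝ | ENNReal.ofReal z.2 < 2 * F z.1}.indicator 1 (x, t) *
            F x ^ τ * ENNReal.ofReal (t ^ (p - τ - 1)) ∂μ := by
        gcongr 1
        refine setLIntegral_mono (hFm.lintegral_prod_left'.const_mul K) fun t ht => ?_
        have ht' : 0 < t := ht
        have hS : MeasurableSet {x | ENNReal.ofReal t < 2 * F x} :=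
          measurableSet_lt measurable_const (hF.const_mul 2)
        have e3 : ENNReal.ofReal (t ^ (p - 1)) =
            ENNReal.ofReal t ^ τ * ENNReal.ofReal (t ^ (p - τ - 1)) := by
          rw [ENNReal.ofReal_rpow_of_pos ht', ← ENNReal.ofReal_mul (by positivity),
            ← Real.rpow_add ht']
          congr 2; ring
        have e2 : ∫⁻ x, {z : X × ℝ | ENNReal.ofReal z.2 < 2 * F z.1}.indicator 1 (x, t) *
            F x ^ τ * ENNReal.ofReal (t ^ (p - τ - 1)) ∂μ =
            (∫⁻ x in {x | ENNReal.ofReal t < 2 * F x}, F x ^ τ ∂μ) *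
              ENNReal.ofReal (t ^ (p - τ - 1)) := by
          rw [← lintegral_indicator hS,
            ← lintegral_mul_const _ ((hF.pow_const τ).indicator hS)]
          refine lintegral_congr fun x => ?_
          by_cases hx : ENNReal.ofReal t < 2 * F x <;> simp [indicator, hx]
        have h0 : ENNReal.ofReal t ^ τ ≠ 0 := by
          rw [ENNReal.ofReal_rpow_of_pos ht']
          simpa using Real.rpow_pos_of_pos ht' τ
        have h1 : ENNReal.ofReal t ^ τ ≠ ∞ :=
          ENNReal.rpow_ne_top_of_nonneg hτ.le ENNReal.ofReal_ne_top
        rw [e2, e3, ← mul_assoc, ← mul_assoc]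
        gcongr ?_ * _
        refine (mul_le_mul_left (h t ht') _).trans (le_of_eq ?_)
        rw [ENNReal.div_mul_cancel h0 h1]
    _ = ENNReal.ofReal p * (K * ∫⁻ x, (∫⁻ t in Ioi (0 : ℝ),
          {z : X × ℝ | ENNReal.ofReal z.2 < 2 * F z.1}.indicator 1 (x, t) *
            F x ^ τ * ENNReal.ofReal (t ^ (p - τ - 1))) ∂μ) := by
        rw [lintegral_const_mul _ hFm.lintegral_prod_left']
        congr 2
        exact (lintegral_lintegral_swap (f := fun x t =>
          {z : X × ℝ | ENNReal.ofReal z.2 < 2 * F z.1}.indicator 1 (x, t) *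
            F x ^ τ * ENNReal.ofReal (t ^ (p - τ - 1))) hFm.aemeasurable).symm
    _ = ENNReal.ofReal p * (K * ∫⁻ x, 2 ^ (p - τ) / ENNReal.ofReal (p - τ) * F x ^ p ∂μ) := by
        congr 2
        refine lintegral_congr fun x => ?_
        have := lintegral_Ioi_indicator_mul_rpow hpτ (2 * F x)
        calc _ = F x ^ τ * ∫⁻ t in Ioi (0 : ℝ), {t : ℝ | ENNReal.ofReal t < 2 * F x}.indicator 1 t *
              ENNReal.ofReal (t ^ (p - τ - 1)) := by
              rw [← lintegral_const_mul]
              · refine lintegral_congr fun t => ?_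
                rw [← mul_assoc, mul_comm (F x ^ τ)]
                rfl
              · exact (measurable_one.indicator
                  (measurableSet_lt ENNReal.measurable_ofReal measurable_const)).mul (hpm (p - τ))
          _ = _ := by
              rw [this, ENNReal.mul_rpow_of_nonneg _ _ hpτ.le]
              have hsplit := ENNReal.rpow_add_of_nonneg (x := F x) τ (p - τ) hτ.le hpτ.le
              rw [add_sub_cancel] at hsplit
              rw [hsplit]
              simp only [div_eq_mul_inv]
              ring
    _ = _ := by
        rw [lintegral_const_mul _ (hF.pow_const p)]
        simp only [div_eq_mul_inv]
        ring

end Interpolation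

/-! ### The full maximal operator and Marcinkiewicz interpolation. -/

section Maximal

variable {X : Type*} [MetricSpace X] [MeasurableSpace X]

theorem ballMaximal_congr_ae {μ : Measure X} {F G : X → ℝ≥0∞} (h : F =ᵐ[μ] G) (x : X) :
    ballMaximal μ F x = ballMaximal μ G x := by
  unfold ballMaximal ballAverage
  simp only [lintegral_congr_ae (ae_restrict_of_ae h)]

theorem ballMaximal_le_essSup {μ : Measure X} (F : X → ℝ≥0∞) (x : X) :
    ballMaximal μ F x ≤ essSup F μ := by
  refine iSup₂_le fun r _ => ?_
  have := setLAverage_le_essSup (μ := μ) (Metric.ball x r) F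
  rw [setLAverage_eq, ENNReal.div_eq_inv_mul] at this
  exact this

theorem ballMaximal_add_const_le {μ : Measure X} {F : X → ℝ≥0∞} (hF : Measurable F) (c : ℝ≥0∞)
    (x : X) : ballMaximal μ (fun y => F y + c) x ≤ ballMaximal μ F x + c := by
  refine iSup₂_le fun r hr => ?_
  unfold ballAverage
  rw [lintegral_add_left hF, mul_add, setLIntegral_const]
  gcongr
  · exact le_iSup₂_of_le (f := fun r (_ : 0 < r) => ballAverage μ r F x) r hr le_rfl
  · calc _ = c * ((μ (Metric.ball x r))⁻¹ * μ (Metric.ball x r)) := by ring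
      _ ≤ c := mul_le_of_le_one_right' (ENNReal.inv_mul_le_one _)

theorem ballMaximal_mono {μ : Measure X} {F G : X → ℝ≥0∞} (h : F ≤ G) (x : X) :
    ballMaximal μ F x ≤ ballMaximal μ G x := by
  unfold ballMaximal ballAverage
  gcongr with r hr y
  exact h y

theorem maximalFunction_eq_ballMaximal {μ : Measure X} {f : X → ℂ} {F : X → ℝ≥0∞}
    (h : (fun x => ‖f x‖ₑ) =ᵐ[μ] F) : maximalFunction μ f = ballMaximal μ F :=
  funext (ballMaximal_congr_ae h)

variable [BorelSpace X]

theorem weakType_ballMaximal [SecondCountableTopology X] {μ : Measure X} {a b δ : ℝ} (ha : 1 < a)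
    (hab : a ≤ b) (hb : b < a ^ 2) (hδ : 0 ≤ δ) (hlen : IsStrictlyIntrinsic X)
    (hhyp : IsGromovHyperbolic X δ) (h : IsLocallyDoubling μ) (hexp : HasPinchedExpGrowth μ a b)
    (o : X) :
    ∃ K : ℝ≥0, ∀ (F : X → ℝ≥0∞), Measurable F → ∀ t : ℝ≥0∞, t ≠ 0 → t ≠ ∞ →
      μ {x | t < ballMaximal μ F x} ≤
        K * (∫⁻ x, F x ^ Real.logb a b ∂μ) / t ^ Real.logb a b := by
  have hτ1 : 1 ≤ Real.logb a b := by
    rw [Real.le_logb_iff_rpow_le ha (by linarith)]; simpa using hab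
  obtain ⟨K₁, hK₁⟩ := weakType_local h hτ1
  obtain ⟨K₂, hK₂⟩ := weakType_global ha hab hb hδ hlen hhyp h hexp o
  refine ⟨K₁ + K₂, fun F hF t ht0 ht => ?_⟩
  calc _ ≤ μ ({x | ∃ r, 0 < r ∧ r ≤ 1 ∧ t < ballAverage μ r F x} ∪
        {x | ∃ r, 1 ≤ r ∧ t < ballAverage μ r F x}) := by
        refine measure_mono fun x hx => ?_
        simp only [ballMaximal, mem_ofPred_eq, lt_iSup_iff] at hx
        obtain ⟨r, hr, hlt⟩ := hx
        rcases le_total r 1 with h1 | h1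
        · exact Or.inl ⟨r, hr, h1, hlt⟩
        · exact Or.inr ⟨r, h1, hlt⟩
    _ ≤ _ := (measure_union_le _ _).trans (add_le_add (hK₁ F hF t ht0 ht) (hK₂ F hF t ht0 ht))
    _ = _ := by
        simp only [div_eq_mul_inv]
        push_cast
        ring

/-- Marcinkiewicz interpolation between the weak type and the trivial `L^∞` bound. -/
theorem lintegral_ballMaximal_rpow_le {μ : Measure X} [SFinite μ] {τ p : ℝ} (hτ : 0 < τ)
    (hp : τ < p) {K : ℝ≥0}
    (hK : ∀ (F : X → ℝ≥0∞), Measurable F → ∀ t : ℝ≥0∞, t ≠ 0 → t ≠ ∞ →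
      μ {x | t < ballMaximal μ F x} ≤ K * (∫⁻ x, F x ^ τ ∂μ) / t ^ τ) :
    ∃ K' : ℝ≥0, ∀ F : X → ℝ≥0∞, Measurable F →
      ∫⁻ x, ballMaximal μ F x ^ p ∂μ ≤ K' * ∫⁻ x, F x ^ p ∂μ := by
  have hp0 : 0 < p := hτ.trans hp
  have hfin : ENNReal.ofReal p * (K * 2 ^ τ) * 2 ^ (p - τ) / ENNReal.ofReal (p - τ) ≠ ∞ := by
    refine ENNReal.div_ne_top ?_ (by simpa using hp)
    refine ENNReal.mul_ne_top (ENNReal.mul_ne_top ENNReal.ofReal_ne_top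
      (ENNReal.mul_ne_top ENNReal.coe_ne_top ?_)) ?_
    · exact ENNReal.rpow_ne_top_of_nonneg hτ.le (by simp)
    · exact ENNReal.rpow_ne_top_of_nonneg (sub_pos.2 hp).le (by simp)
  refine ⟨(ENNReal.ofReal p * (K * 2 ^ τ) * 2 ^ (p - τ) / ENNReal.ofReal (p - τ)).toNNReal,
    fun F hF => ?_⟩
  rw [ENNReal.coe_toNNReal hfin]
  refine lintegral_rpow_le_of_measure_lt_le hτ hp hF (measurable_ballMaximal μ F) fun t ht => ?_
  set s := ENNReal.ofReal t with hs
  have hs0 : s ≠ 0 := by simpa [hs] using ht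
  have hst : s ≠ ∞ := ENNReal.ofReal_ne_top
  have hS : MeasurableSet {x | s < 2 * F x} := measurableSet_lt measurable_const (hF.const_mul 2)
  -- The discarded part of `F` is at most `s / 2`, and so is its contribution to the maximal
  -- function.
  set G : X → ℝ≥0∞ := {x | s < 2 * F x}.indicator F with hG
  have hGm : Measurable G := hF.indicator hS
  have hle : F ≤ fun x => G x + s / 2 := by
    intro x
    by_cases hx : s < 2 * F x
    · simp [hG, hx]
    · simp only [hG, indicator, mem_ofPred_eq, hx, if_false, zero_add]
      rw [ENNReal.le_div_iff_mul_le (by simp) (by simp), mul_comm]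
      exact not_lt.1 hx
  have hpowint : ∫⁻ x, G x ^ τ ∂μ = ∫⁻ x in {x | s < 2 * F x}, F x ^ τ ∂μ := by
    rw [← lintegral_indicator hS]
    refine lintegral_congr fun x => ?_
    by_cases hx : s < 2 * F x
    · simp [hG, indicator, hx]
    · simp [hG, indicator, hx, hτ]
  calc μ {x | s < ballMaximal μ F x} ≤ μ {x | s / 2 < ballMaximal μ G x} := by
        refine measure_mono fun x hx => ?_
        rw [mem_ofPred_eq] at hx ⊢
        have h1 := hx.trans_le ((ballMaximal_mono hle x).trans (ballMaximal_add_const_le hGm _ x))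
        by_contra hcon
        have h2 := h1.trans_le (add_le_add (not_lt.1 hcon) le_rfl)
        rw [ENNReal.add_halves] at h2
        exact lt_irrefl _ h2
    _ ≤ K * (∫⁻ x, G x ^ τ ∂μ) / (s / 2) ^ τ :=
        hK G hGm (s / 2) (by simp [hs0]) (ENNReal.div_ne_top hst (by simp))
    _ = _ := by
        rw [hpowint, ENNReal.div_rpow_of_nonneg _ _ hτ.le, div_eq_mul_inv _ (s ^ τ / 2 ^ τ),
          ENNReal.inv_div (Or.inl (ENNReal.rpow_ne_top_of_nonneg hτ.le (by simp)))
            (Or.inl (by simp)), div_eq_mul_inv, div_eq_mul_inv]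
        ring

end Maximal

/-! ### Passage to complex-valued functions. -/

theorem theorem1p1 {X : Type*} [MetricSpace X] [ConnectedSpace X] [NoncompactSpace X]
    [CompleteSpace X] [MeasurableSpace X] [BorelSpace X] (μ : Measure X)
    (a b δ : ℝ) (ha : 1 < a) (hab : a ≤ b) (hb : b < a ^ 2) (hδ : 0 ≤ δ)
    (hlen : IsStrictlyIntrinsic X) (hhyp : IsGromovHyperbolic X δ)
    (hdbl : IsLocallyDoubling μ) (hexp : HasPinchedExpGrowth μ a b) :
    (∀ p : ℝ≥0∞, ENNReal.ofReal (Real.logb a b) < p →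
      IsBoundedOnLp μ (maximalFunction μ) p) ∧
    IsWeakType μ (maximalFunction μ) (Real.logb a b) := by
  have := hdbl.sigmaFinite
  have := hdbl.secondCountableTopology
  obtain ⟨o⟩ : Nonempty X := inferInstance
  obtain ⟨K, hK⟩ := weakType_ballMaximal ha hab hb hδ hlen hhyp hdbl hexp o
  have hτ0 : 0 < Real.logb a b := Real.logb_pos ha (by linarith)
  refine ⟨fun p hp => ?_, K, fun f hf => ?_⟩
  · induction p with
    | top =>
      refine ⟨1, fun f hf => ?_⟩
      rw [maximalFunction_eq_ballMaximal (Filter.EventuallyEq.refl _ _)]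
      refine ⟨(measurable_ballMaximal μ _).aemeasurable, ?_⟩
      rw [eLpNorm_exponent_top, eLpNorm_exponent_top, ENNReal.coe_one, one_mul]
      exact essSup_le_of_ae_le _ (Filter.Eventually.of_forall fun x => ballMaximal_le_essSup _ x)
    | coe p =>
      have hp' : Real.logb a b < p := by
        rwa [← ENNReal.ofReal_coe_nnreal, ENNReal.ofReal_lt_ofReal_iff_of_nonneg hτ0.le] at hp
      have hp0 : (0 : ℝ) < p := hτ0.trans hp'
      have hpne : (p : ℝ≥0∞) ≠ 0 := by
        rw [ENNReal.coe_ne_zero]; exact fun e => by simp [e] at hp0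
      obtain ⟨K', hK'⟩ := lintegral_ballMaximal_rpow_le hτ0 hp' hK
      refine ⟨K' ^ (1 / (p : ℝ)), fun f hf => ?_⟩
      have hF := hf.1.enorm
      -- Averages ignore null sets, so a measurable representative of `‖f‖` gives the same maximal
      -- function at every point.
      rw [maximalFunction_eq_ballMaximal hF.ae_eq_mk]
      refine ⟨(measurable_ballMaximal μ _).aemeasurable, ?_⟩
      rw [eLpNorm_eq_lintegral_rpow_enorm_toReal hpne ENNReal.coe_ne_top,
        eLpNorm_eq_lintegral_rpow_enorm_toReal hpne ENNReal.coe_ne_top, ENNReal.coe_toReal,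
        ENNReal.coe_rpow_of_nonneg _ (by positivity),
        ← ENNReal.mul_rpow_of_nonneg _ _ (by positivity)]
      refine ENNReal.rpow_le_rpow ?_ (by positivity)
      have e : ∫⁻ x, ‖f x‖ₑ ^ (p : ℝ) ∂μ = ∫⁻ x, hF.mk _ x ^ (p : ℝ) ∂μ :=
        lintegral_congr_ae (hF.ae_eq_mk.mono fun x hx => by simp only [hx])
      rw [e]
      simpa only [enorm_eq_self] using hK' _ hF.measurable_mk
  · have hF := hf.1.enorm
    rw [maximalFunction_eq_ballMaximal hF.ae_eq_mk]
    refine ⟨(measurable_ballMaximal μ _).aemeasurable, fun α hα => ?_⟩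
    refine (hK _ hF.measurable_mk α (ENNReal.coe_ne_zero.2 hα.ne') ENNReal.coe_ne_top).trans
      (le_of_eq ?_)
    have e : ∫⁻ x, ‖f x‖ₑ ^ Real.logb a b ∂μ = ∫⁻ x, hF.mk _ x ^ Real.logb a b ∂μ :=
      lintegral_congr_ae (hF.ae_eq_mk.mono fun x hx => by simp only [hx])
    rw [← e, ENNReal.div_rpow_of_nonneg _ _ hτ0.le,
      eLpNorm_eq_lintegral_rpow_enorm_toReal (by simpa using hτ0) ENNReal.ofReal_ne_top,
      ENNReal.toReal_ofReal hτ0.le, ← ENNReal.rpow_mul, one_div_mul_cancel hτ0.ne',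
      ENNReal.rpow_one, mul_div_assoc]
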